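/- **Setting.** Let $E_1,E_2\in\mathbb R^{2\times2}$ be invertible, $\mathcal R_j=E_j\mathbb Z^2$, $\Gamma_j=\mathbb R^2/\mathcal R_j$, $\mathcal B_j=\mathcal R_j\setminus\{0\}$. Assume that no local arrangement of the bilayer is repeated under translation, i.e. $\mathcal R_1\cap\mathcal R_2=\{0\}$, and that $E_2^{-1}-E_1^{-1}$ is invertible; let $\Gamma_{\mathcal M}=\mathbb R^2/\mathcal R_{\mathcal M}$ with $\mathcal R_{\mathcal M}=(E_2^{-1}-E_1^{-1})^{-1}\mathbb Z^2$ be the moiré cell. Write $|\Gamma|$ for the area of a torus $\Gamma$, and $|F|$ is the Frobenius norm of a matrix $F$. For $j=1,2$ let $V_j$ be a real function of stencils $g=(g_\rho)_{\rho\in\mathcal B_j}$, $g_\rho\in\mathbb R^2$, which for some $\kappa_0>0$ is of class $C^2$ on the ball $\sup_\rho|g_\rho|/|\rho|<\kappa_0$ of the Banach space of stencils with norm $\sup_\rho|g_\rho|/|\rho|$. Assume that its second differential at $g=0$ is the sum of its second partial derivatives, $D^2V_j(0)[h,k]=\sum_{\rho,\sigma\in\mathcal B_j}V_{j,\rho\sigma}(0)[h_\rho,k_\sigma]$,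 with $\sum_{\rho,\sigma}|\rho||\sigma|\,\|V_{j,\rho\sigma}(0)\|<\infty$. Let $W_j(F)=V_j((F\rho)_{\rho\in\mathcal B_j})$ be the Cauchy–Born energy density. **Atomistic stability.** Let $i\ne j$ denote the other layer. For $v\in C(\Gamma_i,\mathbb R^2)$, where $v(\gamma)$ is the displacement of a site of layer $j$ that sees layer $i$ shifted by $\gamma$, let $$E^{\mathrm a}_j(v)=\frac1{|\Gamma_i|}\int_{\Gamma_i}V_j\big((v(\gamma-\rho)-v(\gamma))_{\rho\in\mathcal B_j}\big)\,d\gamma,$$ which is defined for $v$ small. Let $\tilde v$ be the bilinear interpolant of the site displacements: for $(\alpha,\beta)\in\Gamma_j\times\Gamma_i$ and $\alpha=E_j(s,t)^{\mathsf T}$ modulo $\mathcal R_j$, $0\le s,t<1$, $$\begin{aligned}\tilde v(\alpha,\beta)={}&(1-s)(1-t)\,v(\beta-r_{00})+s(1-t)\,v(\beta-r_{10})\\&+(1-s)t\,v(\beta-r_{01})+st\,v(\beta-r_{11}),\qquad r_{ab}=E_j(s-a,t-b)^{\mathsf T}.\end{aligned}$$ Let $\|\nabla v\|_{L^2}^2=\frac1{|\Gamma_j||\Gamma_i|}\int_{\Gamma_j\times\Gamma_i}|\nabla_x\tilde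 v|^2$, where $\nabla_x\tilde v(\alpha,\beta)$ is the gradient at $x=0$ of $x\mapsto\tilde v(\alpha-x,\beta-x)$. Put $$\nu=\min_{j=1,2}\ \inf\{\delta^2E^{\mathrm a}_j(0)[v,v]\ :\ v\in C(\Gamma_i,\mathbb R^2),\ \|\nabla v\|_{L^2}=1\}.$$ **Continuum energy.** Let $W^{1,p}_\#$ be the space of all $u=(u_1,u_2)\in W^{1,p}(\Gamma_{\mathcal M},\mathbb R^2\times\mathbb R^2)$ with $\int_{\Gamma_{\mathcal M}}u_1=\int_{\Gamma_{\mathcal M}}u_2=0$, let $\|\nabla v\|^2_{L^2}=\frac1{|\Gamma_{\mathcal M}|}\int_{\Gamma_{\mathcal M}}(|\nabla v_1|^2+|\nabla v_2|^2)$ for $v\in W^{1,2}_\#$, and let $K=K_\kappa$ be the set of all $u\in W^{1,\infty}_\#$ with $\|\nabla u_1\|_{L^\infty}\le\kappa$ and $\|\nabla u_2\|_{L^\infty}\le\kappa$ (with the operator norm of matrices). The second variation of $E^{\mathrm{CB}}_{\mathcal M}(u)=\frac1{|\Gamma_{\mathcal M}|}\int_{\Gamma_{\mathcal M}}(W_1(\nabla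 u_1)+W_2(\nabla u_2))$ at $u\in K_\kappa$, $\kappa<\kappa_0$, in the direction $v\in W^{1,2}_\#$ is $$\delta^2E^{\mathrm{CB}}_{\mathcal M}(u)[v,v]=\frac1{|\Gamma_{\mathcal M}|}\int_{\Gamma_{\mathcal M}}\sum_{j=1}^2\nabla^2W_j(\nabla u_j)[\nabla v_j,\nabla v_j].$$ **Proposition.** Suppose that $\nu>0$. Then $$\delta^2E^{\mathrm{CB}}_{\mathcal M}(0)[v,v]\ \ge\ \nu\,\|\nabla v\|_{L^2}^2\qquad\text{for all }v\in W^{1,2}_\#.$$ Furthermore, there exists $\kappa_1>0$ such that, for all $0<\kappa<\kappa_1$, $$\delta^2E^{\mathrm{CB}}_{\mathcal M}(u)[v,v]\ \ge\ \tfrac12\,\nu\,\|\nabla v\|_{L^2}^2\qquad\text{for all }v\in W^{1,2}_\#\text{ and all }u\in K_\kappa.$$ -/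

import Mathlib

open MeasureTheory Set
open scoped ENNReal

noncomputable section

namespace Moire

/-! ### Lattices and cells -/

abbrev Plane := EuclideanSpace ℝ (Fin 2)

abbrev Mat := Matrix (Fin 2) (Fin 2) ℝ

/-- The linear map `x ↦ A x` of the Euclidean plane. -/
def act (A : Mat) : Plane →L[ℝ] Plane := Matrix.toEuclideanCLM (𝕜 := ℝ) A

/-- The lattice `A ℤ²`. -/
def lattice (A : Mat) : Set Plane :=
  Set.range fun z : Fin 2 → ℤ => act A (WithLp.toLp 2 fun i => (z i : ℝ))

/-- The unit cell `A [-1/2, 1/2)²`; cell averages of `A ℤ²`-periodic functions are averages over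
the torus `ℝ² / A ℤ²`. -/
def cell (A : Mat) : Set Plane :=
  act A '' {x : Plane | ∀ i, x i ∈ Ico (-(1 / 2) : ℝ) (1 / 2)}

/-- Functions on the torus `ℝ² / A ℤ²`, as periodic functions on the plane. -/
def Periodic {F : Type*} (A : Mat) (f : Plane → F) : Prop :=
  ∀ l ∈ lattice A, ∀ x, f (x + l) = f x

/-- The basis matrix `(E₂⁻¹ - E₁⁻¹)⁻¹` of the moiré lattice of the two layers `E 0`, `E 1`. -/
def moire (E : Fin 2 → Mat) : Mat := ((E 1)⁻¹ - (E 0)⁻¹)⁻¹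

/-- The squared Frobenius norm of a `2 × 2` matrix (given as a linear map). -/
def frobSq (F : Plane →L[ℝ] Plane) : ℝ := ∑ i, ‖F (EuclideanSpace.single i 1)‖ ^ 2

/-! ### Site potentials -/

/-- The bonds `A ℤ² \ {0}` of a layer. -/
abbrev Bond (A : Mat) := {ρ : Plane // ρ ∈ lattice A ∧ ρ ≠ 0}

/-- The Banach space of stencils `g = (g_ρ)` with finite norm `sup_ρ |g_ρ| / |ρ|`. An element `x`
stores the normalized values `x_ρ = g_ρ / |ρ|`, so that its norm is the sup norm. -/
abbrev Stencil (A : Mat) := lp (fun _ : Bond A => Plane) ⊤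

/-- The family `g_ρ = |ρ| x_ρ` described by a normalized stencil `x`. -/
def stencilFamily {A : Mat} (x : Stencil A) : Bond A → Plane := fun ρ => ‖ρ.1‖ • x ρ

/-- The second differential at the reference state `g = 0` of a potential `V`, on the Banach space
of stencils. -/
def hessian {A : Mat} (V : (Bond A → Plane) → ℝ) (h k : Stencil A) : ℝ :=
  iteratedFDeriv ℝ 2 (fun x : Stencil A => V (stencilFamily x)) 0 ![h, k]

open Classical in
/-- The mixed partial derivative `|ρ| |σ| ∂²V / ∂g_ρ ∂g_σ (0) [a, b]`; the factor `|ρ| |σ|` comes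
from the normalization of stencils. -/
def bondHessian {A : Mat} (V : (Bond A → Plane) → ℝ) (ρ σ : Bond A) (a b : Plane) : ℝ :=
  hessian V (lp.single ⊤ ρ a) (lp.single ⊤ σ b)

/-- A many-body site potential: `V` is of class `C²` on the ball of stencils with
`sup_ρ |g_ρ| / |ρ| < κ₀`, and its second differential at `0` is local, that is, it is the sum of
the second partial derivatives `V_{ρσ}(0)`, which satisfy the second moment bound
`∑ |ρ| |σ| ‖V_{ρσ}(0)‖ < ∞`. Only the values of `V` on the ball matter. -/
structure IsSitePotential (A : Mat) (κ₀ : ℝ) (V : (Bond A → Plane) → ℝ) : Prop where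
  contDiffOn : ContDiffOn ℝ 2 (fun x : Stencil A => V (stencilFamily x)) (Metric.ball 0 κ₀)
  moment : ∃ m : Bond A × Bond A → ℝ, Summable m ∧
    ∀ ρ σ a b, |bondHessian V ρ σ a b| ≤ m (ρ, σ) * (‖a‖ * ‖b‖)
  hasSum : ∀ h k : Stencil A,
    HasSum (fun q : Bond A × Bond A => bondHessian V q.1 q.2 (h q.1) (k q.2)) (hessian V h k)

/-! ### The atomistic energy of a layer and its stability constant

A layer has basis matrix `A`, the other layer has basis matrix `B`. The sites of the layer are
labelled by their configurations, which form the torus `ℝ² / B ℤ²`: seen from the bond neighbour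
`ρ`, the configuration `γ` becomes `γ - ρ`. -/

/-- The finite difference stencil `(v(γ - ρ) - v(γ))_ρ`. -/
def diffStencil (A : Mat) (v : Plane → Plane) (γ : Plane) : Bond A → Plane :=
  fun ρ => v (γ - ρ.1) - v γ

/-- The atomistic energy of the layer per site, averaged over configurations. -/
def atomEnergy (A B : Mat) (V : (Bond A → Plane) → ℝ) (v : Plane → Plane) : ℝ :=
  ⨍ γ in cell B, V (diffStencil A v γ)

/-- The second variation at `0` of the atomistic energy, in the direction `v` (twice). -/
def atomSecondVar (A B : Mat) (V : (Bond A → Plane) → ℝ) (v : Plane → Plane) : ℝ :=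
  iteratedDeriv 2 (fun t : ℝ => atomEnergy A B V (fun γ => t • v γ)) 0

/-- The displacement at the origin, in the configuration `(α, β)` of the layer and of the other
layer, of the bilinear interpolant of the displacements `v` of the sites of the layer. With
`α = A (s, t)` modulo `A ℤ²` and `0 ≤ s, t < 1`, the nearest sites are `A (s - a, t - b)` with
`a, b ∈ {0, 1}`. -/
def interpolant (A : Mat) (v : Plane → Plane) (α β : Plane) : Plane :=
  let s := Int.fract (act A⁻¹ α 0)
  let t := Int.fract (act A⁻¹ α 1)
  ((1 - s) * (1 - t)) • v (β - act A !₂[s, t]) +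
    (s * (1 - t)) • v (β - act A !₂[s - 1, t]) +
    ((1 - s) * t) • v (β - act A !₂[s, t - 1]) +
    (s * t) • v (β - act A !₂[s - 1, t - 1])

/-- The spatial gradient of the interpolant, at the origin: moving the point of observation to `x`
changes the configuration `(α, β)` into `(α - x, β - x)`. It exists, for every `v`, unless the
origin is on the boundary of an interpolation cell. -/
def interpolantGrad (A : Mat) (v : Plane → Plane) (α β : Plane) : Plane →L[ℝ] Plane :=
  fderiv ℝ (fun x => interpolant A v (α - x) (β - x)) 0

/-- `‖∇v‖²_{L²}` for site displacements `v`: the average of the squared gradient of the interpolant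
over all configurations of the bilayer. -/
def atomGradSq (A B : Mat) (v : Plane → Plane) : ℝ :=
  ⨍ ω in cell A ×ˢ cell B, frobSq (interpolantGrad A v ω.1 ω.2)

/-- The infimum of the second variation at `0` of the atomistic energy of a layer, over all
continuous `v` with `‖∇v‖_{L²} = 1`. -/
def layerConst (A B : Mat) (V : (Bond A → Plane) → ℝ) : ℝ :=
  sInf {e | ∃ v : Plane → Plane, Continuous v ∧ Periodic B v ∧ atomGradSq A B v = 1 ∧
    e = atomSecondVar A B V v}

/-- The atomistic stability constant `ν` of the bilayer. -/
def stabConst (E : Fin 2 → Mat) (V : ∀ j, (Bond (E j) → Plane) → ℝ) : ℝ :=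
  min (layerConst (E 0) (E 1) (V 0)) (layerConst (E 1) (E 0) (V 1))

/-! ### Sobolev spaces on the moiré cell and the Cauchy–Born energy -/

/-- `v = (v₁, v₂)` belongs to the space `W^{1,p}_#` of periodic, null-average `W^{1,p}` functions on
the torus `ℝ² / M ℤ²`, and `G = (∇v₁, ∇v₂)` is its weak gradient. -/
structure IsSobolev (M : Mat) (p : ℝ≥0∞) (v : Fin 2 → Plane → Plane)
    (G : Fin 2 → Plane → Plane →L[ℝ] Plane) : Prop where
  periodic : ∀ j, Periodic M (v j)
  periodic_grad : ∀ j, Periodic M (G j)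
  memLp : ∀ j, MemLp (v j) p (volume.restrict (cell M))
  memLp_grad : ∀ j, MemLp (G j) p (volume.restrict (cell M))
  weak_grad : ∀ j, ∀ φ : Plane → ℝ, ContDiff ℝ (⊤ : ℕ∞) φ → HasCompactSupport φ → ∀ e : Plane,
    ∫ x, (fderiv ℝ φ x e) • v j x = -∫ x, φ x • G j x e
  average : ∀ j, ⨍ x in cell M, v j x = 0

/-- The admissible set `K` of all `u ∈ W^{1,∞}_#` with `‖∇u_j‖_{L^∞} ≤ κ`, `j = 1, 2`; here `H` is
the weak gradient of `u`, and matrices carry the operator norm. -/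
def IsAdmissible (M : Mat) (κ : ℝ) (u : Fin 2 → Plane → Plane)
    (H : Fin 2 → Plane → Plane →L[ℝ] Plane) : Prop :=
  IsSobolev M ⊤ u H ∧ ∀ j, eLpNorm (H j) ⊤ (volume.restrict (cell M)) ≤ ENNReal.ofReal κ

/-- `‖∇v‖²_{L²}` on the moiré cell (normalized by its area), for the gradient `G = (∇v₁, ∇v₂)`. -/
def gradSq (M : Mat) (G : Fin 2 → Plane → Plane →L[ℝ] Plane) : ℝ :=
  ⨍ x in cell M, ∑ j, frobSq (G j x)

/-- The Cauchy–Born energy density `W(F) = V((F ρ)_ρ)`. -/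
def cauchyBorn {A : Mat} (V : (Bond A → Plane) → ℝ) (F : Plane →L[ℝ] Plane) : ℝ :=
  V fun ρ => F ρ.1

/-- The second variation `δ²E(u)[v, v]` of the Cauchy–Born energy
`E(u) = ⨍ (W₁(∇u₁) + W₂(∇u₂))` on the moiré cell, where `H = ∇u` and `G = ∇v`. As `∇v` may be
unbounded, it is given by its integral expression `⨍ ∑ⱼ ∇²W_j(∇u_j)[∇v_j, ∇v_j]`. -/
def cbSecondVar (E : Fin 2 → Mat) (V : ∀ j, (Bond (E j) → Plane) → ℝ)
    (H G : Fin 2 → Plane → Plane →L[ℝ] Plane) : ℝ :=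
  ⨍ x in cell (moire E), ∑ j, iteratedFDeriv ℝ 2 (cauchyBorn (V j)) (H j x) ![G j x, G j x]

end Moire

end

/-! The bridge between the two energies is the Legendre–Hadamard condition: the second differential
of each `W_j` at `0`, on a rank-one matrix `a ⊗ l`, is at least `ν |a ⊗ l|²`.

Atomistic stability gives this condition by testing with plane waves `γ ↦ Re (c exp (i K γ)) a`,
where `K` lies in 2π times the dual lattice of the other layer, so that the wave is periodic. The
bonds of the layer itself only see `K` modulo 2π times their own dual lattice. Because the two
lattices meet only at `0`, a Kronecker argument (`dense_of_mFourier_ne_one`, `exists_dual_approx`)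
shows that the first dual lattice is dense modulo the second. Hence `K`, however large, can act on
the layer like a long wave of wave vector about `l / n`. For fixed `K` and `a`, both the second
variation and `‖∇v‖²` are quadratic forms in `c ∈ ℂ = ℝ²`. An inequality between such forms passes
to their traces (`add_le_add_of_binary_forms`), and in the traces the oscillating phases cancel, so
no average of an oscillation has to be computed. Multiplied by `n²`, the trace of `‖∇v‖²` tends to
`|a ⊗ l|²`. The trace of the second variation tends to the Cauchy–Born form at `a ⊗ l`, by dominated
convergence under the second moment bound (`tendsto_hessian_wave`). This is `legendre_hadamard`.

The continuum bound at `u = 0` then follows because the form has constant coefficients on a torus.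
By Parseval its average over `∇v` is a sum of its values at the cosine and sine coefficients of
`∇v`, and integration by parts shows that these coefficients have rank one
(`average_mapForm_nonneg`).

For small `u`, the potential is `C²` on the stencil space and a strain is at least as large in
operator norm as its stencil. The second differential therefore moves by at most `ν / 2` when
`‖∇u_j‖_{L^∞}` is small, which costs half of the constant (`exists_close`, `stability`). -/

noncomputable section

namespace Moire

/-! ### Density in the torus -/

/-- The average of `f` over the coset `y + K` of a compact subgroup. -/
def cosetIntegral {d : Type*} [Fintype d] (K : AddSubgroup (UnitAddTorus d)) [CompactSpace K]
    (y : UnitAddTorus d) : C(UnitAddTorus d, ℂ) →L[ℂ] ℂ :=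
  LinearMap.mkContinuous
    { toFun := fun f => ∫ k : K, f (k + y) ∂(Measure.addHaar : Measure K)
      map_add' := fun f g => by
        refine integral_add ?_ ?_ <;>
        exact Continuous.integrable_of_hasCompactSupport (by fun_prop)
          (HasCompactSupport.of_compactSpace _)
      map_smul' := fun c f => by
        simp only [ContinuousMap.smul_apply, RingHom.id_apply]
        exact integral_smul _ _ }
    ((Measure.addHaar : Measure K).real univ) (fun f => by
      rw [mul_comm]
      exact norm_integral_le_of_norm_le_const (Filter.Eventually.of_forall fun k =>
        f.norm_coe_le_norm _))

theorem cosetIntegral_apply {d : Type*} [Fintype d] (K : AddSubgroup (UnitAddTorus d))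
    [CompactSpace K] (y : UnitAddTorus d) (f : C(UnitAddTorus d, ℂ)) :
    cosetIntegral K y f = ∫ k : K, f (k + y) ∂(Measure.addHaar : Measure K) := rfl

theorem mFourier_add_apply {d : Type*} [Fintype d] (m : d → ℤ) (x y : UnitAddTorus d) :
    UnitAddTorus.mFourier m (x + y) = UnitAddTorus.mFourier m x * UnitAddTorus.mFourier m y := by
  simp [UnitAddTorus.mFourier, fourier_apply, smul_add, AddCircle.toCircle_add,
    Finset.prod_mul_distrib]

/-- A subgroup of the torus on which no nontrivial character is trivial is dense. -/
theorem dense_of_mFourier_ne_one {d : Type*} [Fintype d] (H : AddSubgroup (UnitAddTorus d))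
    (h : ∀ m : d → ℤ, m ≠ 0 → ∃ x ∈ H, UnitAddTorus.mFourier m x ≠ 1) :
    Dense (H : Set (UnitAddTorus d)) := by
  classical
  set K := H.topologicalClosure with hK
  have hKc : IsClosed (K : Set (UnitAddTorus d)) := H.isClosed_topologicalClosure
  have : CompactSpace K := isCompact_iff_compactSpace.mp hKc.isCompact
  have hHK : H ≤ K := H.le_topologicalClosure
  -- Translating by an element of `K` on which the character is not `1` preserves Haar measure but
  -- multiplies the integral by a factor different from `1`.
  have hzero : ∀ m : d → ℤ, m ≠ 0 → ∀ y, cosetIntegral K y (UnitAddTorus.mFourier m) = 0 := by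
    intro m hm y
    obtain ⟨x, hx, hx1⟩ := h m hm
    have h1 : cosetIntegral K y (UnitAddTorus.mFourier m) =
        UnitAddTorus.mFourier m x * cosetIntegral K y (UnitAddTorus.mFourier m) := by
      rw [cosetIntegral_apply]
      conv_lhs => rw [← integral_add_left_eq_self _ (⟨x, hHK hx⟩ : K)]
      rw [← integral_const_mul]
      congr 1
      ext k
      rw [AddSubgroup.coe_add, add_assoc, mFourier_add_apply]
    have h2 : (1 - UnitAddTorus.mFourier m x) *
        cosetIntegral K y (UnitAddTorus.mFourier m) = 0 := by
      rw [sub_mul, one_mul, ← h1, sub_self]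
    exact (mul_eq_zero.mp h2).resolve_left (sub_ne_zero.mpr hx1.symm)
  -- Trigonometric polynomials are dense, so continuous functionals that agree on characters agree
  -- everywhere: all cosets of `K` give the same functional.
  have hconst : ∀ y, cosetIntegral K y = cosetIntegral K 0 := by
    intro y
    refine ContinuousLinearMap.ext_on (s := range UnitAddTorus.mFourier) ?_ ?_
    · exact Submodule.dense_iff_topologicalClosure_eq_top.mpr
        UnitAddTorus.span_mFourier_closure_eq_top
    · rintro _ ⟨m, rfl⟩
      by_cases hm : m = 0
      · subst hm
        simp [cosetIntegral_apply, UnitAddTorus.mFourier_zero]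
      · rw [hzero m hm, hzero m hm]
  -- Otherwise a Urysohn function separates `K` from its disjoint coset `K + y`; its integrals over
  -- them are `0` and the positive Haar mass of `K`.
  have hKall : ∀ y, y ∈ K := by
    intro y
    by_contra hy
    have hdisj : Disjoint (K : Set (UnitAddTorus d)) ((· + y) '' K) := by
      rw [Set.disjoint_left]
      rintro _ h1 ⟨k, hk, rfl⟩
      exact hy ((AddSubgroup.add_mem_cancel_left K hk).mp h1)
    have hclosed : IsClosed ((· + y) '' (K : Set (UnitAddTorus d))) :=
      (Homeomorph.addRight y).isClosedMap _ hKc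
    obtain ⟨f, hf0, hf1, -⟩ := exists_continuous_zero_one_of_isClosed hKc hclosed hdisj
    let g : C(UnitAddTorus d, ℂ) := ⟨fun x => (f x : ℂ), by fun_prop⟩
    have e1 : cosetIntegral K 0 g = 0 := by
      rw [cosetIntegral_apply]
      refine integral_eq_zero_of_ae (Filter.Eventually.of_forall fun k => ?_)
      simp [g, hf0 k.2]
    have e2 : cosetIntegral K y g = ((Measure.addHaar : Measure K).real univ : ℂ) := by
      rw [cosetIntegral_apply]
      have : ∀ k : K, g (k + y) = 1 := fun k => by
        simp [g, hf1 ⟨k, k.2, rfl⟩]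
      simp [this]
    rw [hconst y, e1] at e2
    have : (Measure.addHaar : Measure K).real univ ≠ 0 := by
      rw [Measure.real, ENNReal.toReal_ne_zero]
      exact ⟨NeZero.ne _, measure_ne_top _ _⟩
    exact this (by exact_mod_cast e2.symm)
  intro y
  exact hKall y

/-! ### The action of matrices -/

theorem act_apply (A : Mat) (x : Plane) (i : Fin 2) : act A x i = ∑ j, A i j * x j := rfl

theorem act_act_inv {A : Mat} (hA : A.det ≠ 0) (x : Plane) : act A (act A⁻¹ x) = x := by
  have h : act A * act A⁻¹ = 1 := by
    rw [act, act, ← map_mul, Matrix.mul_nonsing_inv _ (isUnit_iff_ne_zero.mpr hA), map_one]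
  exact DFunLike.congr_fun h x

theorem act_inv_act {A : Mat} (hA : A.det ≠ 0) (x : Plane) : act A⁻¹ (act A x) = x := by
  have h : act A⁻¹ * act A = 1 := by
    rw [act, act, ← map_mul, Matrix.nonsing_inv_mul _ (isUnit_iff_ne_zero.mpr hA), map_one]
  exact DFunLike.congr_fun h x

/-- The coordinate vector of an integer point. -/
def intVec (z : Fin 2 → ℤ) : Plane := WithLp.toLp 2 fun i => (z i : ℝ)

@[simp] theorem intVec_apply (z : Fin 2 → ℤ) (i : Fin 2) : intVec z i = z i := rfl

theorem act_intVec_mem (A : Mat) (z : Fin 2 → ℤ) : act A (intVec z) ∈ lattice A := ⟨z, rfl⟩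

/-- Simultaneous approximation: if two planar lattices only meet at `0`, then the dual lattice of
one of them is dense modulo the dual lattice of the other. -/
theorem exists_dual_approx {A B : Mat} (hA : A.det ≠ 0) (hB : B.det ≠ 0)
    (hAB : lattice A ∩ lattice B = {0}) (θ : Fin 2 → ℝ) {ε : ℝ} (hε : 0 < ε) :
    ∃ n m : Fin 2 → ℤ, ∀ i, |∑ l, (n l : ℝ) * (B⁻¹ * A) l i - m i - θ i| < ε := by
  set D := B⁻¹ * A with hD
  let x : (Fin 2 → ℤ) →+ UnitAddTorus (Fin 2) :=
    { toFun := fun n i => ((∑ l, (n l : ℝ) * D l i : ℝ) : UnitAddCircle)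
      map_zero' := by ext i; simp
      map_add' := fun a b => by
        ext i
        simp only [Pi.add_apply, Int.cast_add, add_mul, Finset.sum_add_distrib]
        exact AddCircle.coe_add _ _ _ }
  have hdense : Dense (x.range : Set (UnitAddTorus (Fin 2))) := by
    apply dense_of_mFourier_ne_one
    intro m hm
    by_contra! hcon
    -- A character that is trivial on the subgroup generated by the rows of `D` satisfies `D m ∈
    -- ℤ²`; it suffices to test the generators.
    have hint : ∀ l, ∃ z : ℤ, (∑ i, D l i * m i) = z := by
      intro l
      have h1 := hcon (x (Pi.single l 1)) ⟨_, rfl⟩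
      have h2 : ∀ i, x (Pi.single l 1) i = ((D l i : ℝ) : UnitAddCircle) := by
        intro i
        change ((∑ l', (((Pi.single l 1 : Fin 2 → ℤ) l' : ℤ) : ℝ) * D l' i : ℝ) : UnitAddCircle) = _
        congr 1
        rw [Finset.sum_eq_single l] <;> simp +contextual
      simp only [UnitAddTorus.mFourier, ContinuousMap.coe_mk, h2, fourier_coe_apply,
        ← Complex.exp_sum] at h1
      obtain ⟨z, hz⟩ := Complex.exp_eq_one_iff.mp h1
      refine ⟨z, ?_⟩
      have h3 : ((∑ i, D l i * m i : ℝ) : ℂ) * (2 * Real.pi * Complex.I) =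
          z * (2 * Real.pi * Complex.I) := by
        rw [← hz]
        push_cast
        rw [Finset.sum_mul]
        refine Finset.sum_congr rfl fun i _ => ?_
        ring
      have h4 := mul_right_cancel₀ Complex.two_pi_I_ne_zero h3
      exact_mod_cast h4
    choose z hz using hint
    -- From `B⁻¹ A m = z` follows a common vector of the two lattices, which must be `0`.
    have h1 : act B (intVec z) = act A (intVec m) := by
      have h2 : intVec z = act B⁻¹ (act A (intVec m)) := by
        ext l
        have h3 : act B⁻¹ (act A (intVec m)) = act D (intVec m) := by
          have h4 : act B⁻¹ * act A = act D := by rw [act, act, ← map_mul]; rfl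
          exact DFunLike.congr_fun h4 _
        rw [h3, act_apply, intVec_apply, ← hz l]
        rfl
      rw [h2, act_act_inv hB]
    have h2 : act A (intVec m) ∈ lattice A ∩ lattice B :=
      ⟨act_intVec_mem A m, h1 ▸ act_intVec_mem B z⟩
    rw [hAB, mem_singleton_iff] at h2
    have h3 : intVec m = 0 := by rw [← act_inv_act hA (intVec m), h2, map_zero]
    apply hm
    ext i
    have := congrArg (fun v : Plane => v i) h3
    simpa using this
  obtain ⟨_, ⟨n, rfl⟩, hy⟩ := hdense.exists_dist_lt (fun i => ((θ i : ℝ) : UnitAddCircle)) hε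
  -- The norm on the circle is the distance to the nearest integer, so rounding supplies `m`.
  refine ⟨n, fun i => round (∑ l, (n l : ℝ) * D l i - θ i), fun i => ?_⟩
  have h1 := lt_of_le_of_lt (dist_le_pi_dist _ _ i) hy
  rw [dist_comm, dist_eq_norm] at h1
  change ‖((∑ l, (n l : ℝ) * D l i : ℝ) : UnitAddCircle) - ((θ i : ℝ) : UnitAddCircle)‖ < ε at h1
  rw [← AddCircle.coe_sub, UnitAddCircle.norm_eq] at h1
  rwa [sub_right_comm]

end Moire
end

noncomputable section

namespace Moire

/-! ### Cell averages -/

/-- The unit cell `[-1/2, 1/2)²`. -/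
def unitCell : Set Plane := {x : Plane | ∀ i, x i ∈ Ico (-(1 / 2) : ℝ) (1 / 2)}

theorem measurableSet_unitCell : MeasurableSet unitCell := by
  have : unitCell = ⋂ i, (fun x : Plane => x i) ⁻¹' Ico (-(1 / 2) : ℝ) (1 / 2) := by
    ext x; simp [unitCell]
  rw [this]
  exact MeasurableSet.iInter fun i =>
    ((EuclideanSpace.proj (𝕜 := ℝ) i).continuous.measurable measurableSet_Ico)

theorem unitCell_eq_preimage : unitCell =
    WithLp.ofLp ⁻¹' (univ.pi fun _ : Fin 2 => Ico (-(1 / 2) : ℝ) (1 / 2)) := by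
  ext x
  simp [unitCell]

theorem volume_unitCell : volume unitCell = 1 := by
  rw [unitCell_eq_preimage, (PiLp.volume_preserving_ofLp (Fin 2)).measure_preimage
    (MeasurableSet.univ_pi fun _ => measurableSet_Ico).nullMeasurableSet, volume_pi_pi]
  norm_num

instance : IsProbabilityMeasure (volume.restrict unitCell) :=
  ⟨by rw [Measure.restrict_apply_univ, volume_unitCell]⟩

/-- An invertible matrix as a linear homeomorphism of the plane. -/
def actEquiv {A : Mat} (hA : A.det ≠ 0) : Plane ≃L[ℝ] Plane :=
  ContinuousLinearEquiv.equivOfInverse (act A) (act A⁻¹) (act_inv_act hA) (act_act_inv hA)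

theorem det_act (A : Mat) : LinearMap.det (act A : Plane →ₗ[ℝ] Plane) = A.det := by
  have : (act A : Plane →ₗ[ℝ] Plane) = Matrix.toLin (PiLp.basisFun 2 ℝ (Fin 2))
      (PiLp.basisFun 2 ℝ (Fin 2)) A := by
    refine (PiLp.basisFun 2 ℝ (Fin 2)).ext fun j => ?_
    rw [Matrix.toLin_self]
    ext i
    simp [act_apply, PiLp.basisFun_apply, Fin.sum_univ_two]
    fin_cases j <;> fin_cases i <;> simp
  rw [this, LinearMap.det_toLin]

theorem cell_eq (A : Mat) : cell A = act A '' unitCell := rfl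

theorem volume_cell (A : Mat) : volume (cell A) = ENNReal.ofReal |A.det| := by
  have := Measure.addHaar_image_linearMap volume (act A : Plane →ₗ[ℝ] Plane) unitCell
  rwa [volume_unitCell, mul_one, det_act] at this

theorem map_act_unitCell {A : Mat} (hA : A.det ≠ 0) :
    Measure.map (act A) (volume.restrict unitCell) =
      ENNReal.ofReal |A.det⁻¹| • volume.restrict (cell A) := by
  have hemb : MeasurableEmbedding (act A) := (actEquiv hA).toHomeomorph.measurableEmbedding
  have h1 := Measure.map_linearMap_addHaar_eq_smul_addHaar volume
    (f := (act A : Plane →ₗ[ℝ] Plane)) (by rwa [det_act])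
  rw [det_act] at h1
  have h2 : Measure.map (act A) volume = ENNReal.ofReal |A.det⁻¹| • volume := h1
  rw [← Measure.restrict_smul, ← h2, hemb.restrict_map, cell_eq,
    preimage_image_eq _ hemb.injective]

variable {F : Type*} [NormedAddCommGroup F] [NormedSpace ℝ F]

theorem average_cell {A : Mat} (hA : A.det ≠ 0) (f : Plane → F) :
    ⨍ x in cell A, f x = ∫ y in unitCell, f (act A y) := by
  have hemb : MeasurableEmbedding (act A) := (actEquiv hA).toHomeomorph.measurableEmbedding
  rw [← hemb.integral_map, map_act_unitCell hA, integral_smul_measure, setAverage_eq,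
    measureReal_def, volume_cell, ENNReal.toReal_ofReal (abs_nonneg _),
    ENNReal.toReal_ofReal (abs_nonneg _), abs_inv]

omit [NormedSpace ℝ F] in
theorem memLp_comp_act {A : Mat} (hA : A.det ≠ 0) {p : ℝ≥0∞} {f : Plane → F}
    (hf : MemLp f p (volume.restrict (cell A))) :
    MemLp (fun y => f (act A y)) p (volume.restrict unitCell) := by
  have hemb : MeasurableEmbedding (act A) := (actEquiv hA).toHomeomorph.measurableEmbedding
  have h1 : MemLp f p (Measure.map (act A) (volume.restrict unitCell)) := by
    rw [map_act_unitCell hA]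
    exact hf.smul_measure ENNReal.ofReal_ne_top
  exact (hemb.memLp_map_measure_iff).mp h1

theorem ae_comp_act {A : Mat} (hA : A.det ≠ 0) {p : Plane → Prop}
    (h : ∀ᵐ x ∂(volume.restrict (cell A)), p x) :
    ∀ᵐ y ∂(volume.restrict unitCell), p (act A y) := by
  have hemb : MeasurableEmbedding (act A) := (actEquiv hA).toHomeomorph.measurableEmbedding
  have h1 : ∀ᵐ x ∂(Measure.map (act A) (volume.restrict unitCell)), p x := by
    rw [map_act_unitCell hA]
    exact Measure.ae_smul_measure h _
  exact (hemb.ae_map_iff).mp h1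

/-! ### Fourier series on the unit cell -/

/-- The phase `2π k · y`. -/
def phase (k : Fin 2 → ℤ) (y : Plane) : ℝ := 2 * Real.pi * ∑ i, (k i : ℝ) * y i

@[fun_prop] theorem continuous_phase (k : Fin 2 → ℤ) : Continuous (phase k) := by
  unfold phase
  fun_prop

/-- The cosine coefficient of `f` on the unit cell. -/
def cosCoeff (f : Plane → F) (k : Fin 2 → ℤ) : F :=
  ∫ y in unitCell, Real.cos (phase k y) • f y

/-- The sine coefficient of `f` on the unit cell. -/
def sinCoeff (f : Plane → F) (k : Fin 2 → ℤ) : F :=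
  ∫ y in unitCell, Real.sin (phase k y) • f y

theorem integrable_cos_smul {f : Plane → F} (hf : Integrable f (volume.restrict unitCell))
    (k : Fin 2 → ℤ) :
    Integrable (fun y => Real.cos (phase k y) • f y) (volume.restrict unitCell) :=
  by
  refine hf.bdd_smul (C := 1) ?_ ?_
  · exact (Real.continuous_cos.comp (continuous_phase k)).aestronglyMeasurable
  · exact Filter.Eventually.of_forall fun y => Real.abs_cos_le_one _

theorem integrable_sin_smul {f : Plane → F} (hf : Integrable f (volume.restrict unitCell))
    (k : Fin 2 → ℤ) :
    Integrable (fun y => Real.sin (phase k y) • f y) (volume.restrict unitCell) :=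
  by
  refine hf.bdd_smul (C := 1) ?_ ?_
  · exact (Real.continuous_sin.comp (continuous_phase k)).aestronglyMeasurable
  · exact Filter.Eventually.of_forall fun y => Real.abs_sin_le_one _

attribute [local instance] instMeasureSpaceUnitAddCircle

/-- The representative in `(-1/2, 1/2]²` of a point of the torus. -/
def torusRep (t : UnitAddTorus (Fin 2)) : Plane :=
  WithLp.toLp 2 ((UnitAddTorus.measurableEquivPiIoc fun _ => -(1 / 2)) t).1

theorem coe_torusRep (t : UnitAddTorus (Fin 2)) (i : Fin 2) :
    ((torusRep t i : ℝ) : UnitAddCircle) = t i :=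
  (AddCircle.equivIoc 1 (-(1 / 2))).symm_apply_apply (t i)

theorem measurableEmbedding_torusRep : MeasurableEmbedding torusRep := by
  have hS : MeasurableSet {x : Fin 2 → ℝ | ∀ i, x i ∈ Ioc (-(1 / 2) : ℝ) (-(1 / 2) + 1)} :=
    MeasurableSet.univ_pi' fun _ => measurableSet_Ioc
  exact (MeasurableEquiv.toLp 2 (Fin 2 → ℝ)).measurableEmbedding.comp
    ((MeasurableEmbedding.subtype_coe hS).comp
      (UnitAddTorus.measurableEquivPiIoc fun _ => -(1 / 2)).measurableEmbedding)

theorem measurePreserving_torusRep :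
    MeasurePreserving torusRep volume (volume.restrict unitCell) := by
  have h1 := UnitAddTorus.measurePreserving_equivPiIoc (d := Fin 2) fun _ => -(1 / 2)
  have hS : MeasurableSet {x : Fin 2 → ℝ | ∀ i, x i ∈ Ioc (-(1 / 2) : ℝ) (-(1 / 2) + 1)} :=
    MeasurableSet.univ_pi' fun _ => measurableSet_Ioc
  have h2 := (measurePreserving_subtype_coe (μa := volume) hS).comp h1
  have h3 := ((EuclideanSpace.volume_preserving_symm_measurableEquiv_toLp (Fin 2)).symm.restrict_preimage
    (s := unitCell) measurableSet_unitCell)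
  -- The representatives fill the cell that is closed on the right, `unitCell` is closed on the
  -- left; they differ by a null set.
  have h4 : (volume : Measure (Fin 2 → ℝ)).restrict
      {x : Fin 2 → ℝ | ∀ i, x i ∈ Ioc (-(1 / 2) : ℝ) (-(1 / 2) + 1)} =
      volume.restrict (WithLp.toLp 2 ⁻¹' unitCell) := by
    apply Measure.restrict_congr_set
    have e1 : {x : Fin 2 → ℝ | ∀ i, x i ∈ Ioc (-(1 / 2) : ℝ) (-(1 / 2) + 1)} =
        univ.pi fun _ => Ioc (-(1 / 2) : ℝ) (1 / 2) := by
      ext x; norm_num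
    have e2 : WithLp.toLp 2 ⁻¹' unitCell =
        univ.pi fun _ : Fin 2 => Ico (-(1 / 2) : ℝ) (1 / 2) := by
      ext x; simp [unitCell]
    rw [e1, e2]
    exact Measure.univ_pi_Ioc_ae_eq_Icc.trans Measure.univ_pi_Ico_ae_eq_Icc.symm
  rw [h4] at h2
  exact h3.comp h2

theorem mFourier_torusRep (k : Fin 2 → ℤ) (t : UnitAddTorus (Fin 2)) :
    UnitAddTorus.mFourier (-k) t =
      Real.cos (phase k (torusRep t)) - Real.sin (phase k (torusRep t)) * Complex.I := by
  have h1 : UnitAddTorus.mFourier (-k) t =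
      Complex.exp ((-phase k (torusRep t) : ℝ) * Complex.I) := by
    simp only [UnitAddTorus.mFourier, ContinuousMap.coe_mk]
    have h2 : ∀ i, fourier ((-k) i) (t i) =
        fourier ((-k) i) ((torusRep t i : ℝ) : UnitAddCircle) := fun i => by rw [coe_torusRep]
    simp only [h2, fourier_coe_apply, ← Complex.exp_sum]
    congr 1
    simp [phase, Fin.sum_univ_two]
    ring_nf
  rw [h1, Complex.exp_mul_I, ← Complex.ofReal_cos, ← Complex.ofReal_sin, Real.cos_neg,
    Real.sin_neg]
  push_cast
  ring

theorem mFourierCoeff_torusRep {f : Plane → ℝ} (hf : Integrable f (volume.restrict unitCell))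
    (k : Fin 2 → ℤ) :
    UnitAddTorus.mFourierCoeff (fun t => (f (torusRep t) : ℂ)) k =
      cosCoeff f k - sinCoeff f k * Complex.I := by
  let g : Plane → ℂ := fun y => (Real.cos (phase k y) - Real.sin (phase k y) * Complex.I) * f y
  have h1 : UnitAddTorus.mFourierCoeff (fun t => (f (torusRep t) : ℂ)) k =
      ∫ t, g (torusRep t) := by
    refine integral_congr_ae (Filter.Eventually.of_forall fun t => ?_)
    simp only [mFourier_torusRep, smul_eq_mul, g]
  rw [h1, measurePreserving_torusRep.integral_comp measurableEmbedding_torusRep g]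
  have hc : Integrable (fun y => ((Real.cos (phase k y) • f y : ℝ) : ℂ))
      (volume.restrict unitCell) := (integrable_cos_smul hf k).ofReal (𝕜 := ℂ)
  have hs : Integrable (fun y => ((Real.sin (phase k y) • f y : ℝ) : ℂ))
      (volume.restrict unitCell) := (integrable_sin_smul hf k).ofReal (𝕜 := ℂ)
  rw [cosCoeff, sinCoeff, ← integral_complex_ofReal, ← integral_complex_ofReal,
    ← integral_mul_const, ← integral_sub hc (hs.mul_const _)]
  congr 1
  ext y
  simp [g]
  ring_nf

/-- Parseval's identity for real functions on the unit cell. -/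
theorem hasSum_cosCoeff_mul_add_sinCoeff_mul {f g : Plane → ℝ}
    (hf : MemLp f 2 (volume.restrict unitCell)) (hg : MemLp g 2 (volume.restrict unitCell)) :
    HasSum (fun k => cosCoeff f k * cosCoeff g k + sinCoeff f k * sinCoeff g k)
      (∫ y in unitCell, f y * g y) := by
  have hlift : ∀ {h : Plane → ℝ}, MemLp h 2 (volume.restrict unitCell) →
      MemLp (fun t => (h (torusRep t) : ℂ)) 2 (volume : Measure (UnitAddTorus (Fin 2))) :=
    fun hh => (hh.comp_measurePreserving measurePreserving_torusRep).ofReal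
  have h1 := UnitAddTorus.hasSum_prod_mFourierCoeff (hlift hf).toLp (hlift hg).toLp
  have hcoe : ∀ {h : Plane → ℝ} (hh : MemLp h 2 (volume.restrict unitCell)) (k : Fin 2 → ℤ),
      UnitAddTorus.mFourierCoeff ((hlift hh).toLp) k =
        cosCoeff h k - sinCoeff h k * Complex.I := by
    intro h hh k
    rw [← mFourierCoeff_torusRep (hh.integrable (by norm_num)) k]
    refine integral_congr_ae ?_
    filter_upwards [(hlift hh).coeFn_toLp] with t ht
    rw [ht]
  -- For real functions the complex coefficient is `c - i s`, and the real part of `conj (c_f - i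
  -- s_f) (c_g - i s_g)` is `c_f c_g + s_f s_g`.
  have h2 := Complex.reCLM.hasSum h1
  have h3 : ∫ t, (starRingEnd ℂ) ((hlift hf).toLp _ t) * (hlift hg).toLp _ t =
      ((∫ y in unitCell, f y * g y : ℝ) : ℂ) := by
    rw [← integral_complex_ofReal, ← measurePreserving_torusRep.integral_comp
      measurableEmbedding_torusRep]
    refine integral_congr_ae ?_
    filter_upwards [(hlift hf).coeFn_toLp, (hlift hg).coeFn_toLp] with t h4 h5
    rw [h4, h5]
    simp
  rw [h3] at h2
  convert! h2 using 1
  ext k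
  rw [hcoe hf, hcoe hg]
  simp

end Moire
end

noncomputable section

namespace Moire

/-! ### Periodic test functions -/

/-- A smooth bump, supported in `[-1, 1]`, whose integer translates sum up to one. -/
def unitBump (t : ℝ) : ℝ := Real.smoothTransition (t + 1) - Real.smoothTransition t

theorem contDiff_unitBump : ContDiff ℝ (⊤ : ℕ∞) unitBump := by
  have h : ContDiff ℝ (⊤ : ℕ∞) Real.smoothTransition := Real.smoothTransition.contDiff
  exact (h.comp (contDiff_id.add contDiff_const)).sub h

theorem unitBump_eq_zero {t : ℝ} (ht : 1 ≤ |t|) : unitBump t = 0 := by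
  unfold unitBump
  rcases le_abs'.mp ht with h | h
  · rw [Real.smoothTransition.zero_of_nonpos (by linarith),
      Real.smoothTransition.zero_of_nonpos (by linarith), sub_zero]
  · rw [Real.smoothTransition.one_of_one_le (by linarith),
      Real.smoothTransition.one_of_one_le (by linarith), sub_self]

/-- Telescoping leaves `S (t + 2) - S (t - 1)` for the smooth step `S`, which is `1 - 0` on the
stated range. -/
theorem sum_unitBump {t : ℝ} (ht : |t| < 1) :
    ∑ n ∈ Finset.Icc (-1 : ℤ) 1, unitBump (t + n) = 1 := by
  have h : Finset.Icc (-1 : ℤ) 1 = {-1, 0, 1} := by decide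
  obtain ⟨h1, h2⟩ := abs_lt.mp ht
  rw [h, Finset.sum_insert (by decide), Finset.sum_insert (by decide), Finset.sum_singleton]
  simp only [unitBump]
  push_cast
  rw [show t + -1 + 1 = t + 0 by ring, Real.smoothTransition.one_of_one_le (x := t + 1 + 1)
    (by linarith), Real.smoothTransition.zero_of_nonpos (x := t + -1) (by linarith)]
  ring_nf

/-- The planar bump `h(y₁) h(y₂)`. -/
def planeBump (y : Plane) : ℝ := ∏ i, unitBump (y i)

/-- The integer translations with entries in `{-1, 0, 1}`. -/
def nearShifts : Finset (Fin 2 → ℤ) := Fintype.piFinset fun _ => Finset.Icc (-1) 1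

theorem contDiff_planeBump : ContDiff ℝ (⊤ : ℕ∞) planeBump := by
  unfold planeBump
  refine contDiff_prod fun i _ => contDiff_unitBump.comp ?_
  exact (EuclideanSpace.proj (𝕜 := ℝ) i).contDiff

theorem planeBump_eq_zero {y : Plane} (hy : ∃ i, 1 ≤ |y i|) : planeBump y = 0 := by
  obtain ⟨i, hi⟩ := hy
  exact Finset.prod_eq_zero (Finset.mem_univ i) (unitBump_eq_zero hi)

theorem sum_planeBump {y : Plane} (hy : ∀ i, |y i| < 1) :
    ∑ k ∈ nearShifts, planeBump (y + intVec k) = 1 := by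
  have := Finset.prod_univ_sum (fun _ : Fin 2 => Finset.Icc (-1 : ℤ) 1)
    (fun i n => unitBump (y i + n))
  rw [Finset.prod_congr rfl fun i _ => sum_unitBump (hy i), Finset.prod_const_one] at this
  exact this.symm

theorem isCompact_square : IsCompact {y : Plane | ∀ i, |y i| ≤ 1} := by
  have : {y : Plane | ∀ i, |y i| ≤ 1} =
      (EuclideanSpace.equiv (Fin 2) ℝ).toHomeomorph ⁻¹' (univ.pi fun _ => Icc (-1) 1) := by
    ext y
    simp only [mem_ofPred_eq, mem_preimage, mem_univ_pi, mem_Icc, abs_le]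
    rfl
  rw [this, Homeomorph.isCompact_preimage]
  exact isCompact_univ_pi fun _ => isCompact_Icc

variable {F : Type*} [NormedAddCommGroup F] [NormedSpace ℝ F]

/-- The integral of a function supported in the square `[-1, 1]²` as a sum over unit cells. -/
theorem integral_eq_sum_unitCell {f : Plane → F} (hf : ∀ y, (∃ i, 1 < |y i|) → f y = 0)
    (hint : ∀ k, Integrable (fun y => f (y + intVec k)) (volume.restrict unitCell)) :
    ∫ y, f y = ∑ k ∈ nearShifts, ∫ y in unitCell, f (y + intVec k) := by
  let T : (Fin 2 → ℤ) → Set Plane := fun k => (fun y => y + intVec k) '' unitCell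
  have hemb : ∀ k, MeasurableEmbedding fun y : Plane => y + intVec k :=
    fun k => measurableEmbedding_addRight _
  have hT : ∀ k, MeasurableSet (T k) := fun k =>
    (hemb k).measurableSet_image.mpr measurableSet_unitCell
  have hmp : ∀ k, MeasurePreserving (fun y : Plane => y + intVec k)
      (volume.restrict unitCell) (volume.restrict (T k)) := fun k =>
    (measurePreserving_add_right volume (intVec k)).restrict_image_emb (hemb k) _
  have hdisj : ((nearShifts : Finset (Fin 2 → ℤ)) : Set (Fin 2 → ℤ)).Pairwise
      (Function.onFun Disjoint T) := by
    intro k _ l _ hkl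
    rw [Function.onFun, Set.disjoint_left]
    rintro _ ⟨y, hy, rfl⟩ ⟨z, hz, hzy⟩
    apply hkl
    ext i
    have h1 : z i + l i = y i + k i := congrArg (fun v : Plane => v i) hzy
    have h2 := hy i
    have h3 := hz i
    have h4 : ((k i - l i : ℤ) : ℝ) < 1 := by push_cast; linarith [h2.1, h3.2]
    have h5 : (-1 : ℝ) < ((k i - l i : ℤ) : ℝ) := by push_cast; linarith [h2.2, h3.1]
    have h6 : k i - l i < 1 := by exact_mod_cast h4
    have h7 : -1 < k i - l i := by exact_mod_cast h5
    omega
  have hon : ∀ k ∈ nearShifts, IntegrableOn f (T k) := fun k _ =>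
    ((hmp k).integrable_comp_emb (hemb k)).mp (hint k)
  have hzero : ∀ y, y ∉ (⋃ k ∈ nearShifts, T k) → f y = 0 := by
    intro y hy
    by_contra hne
    apply hy
    have hle : ∀ i, |y i| ≤ 1 := by
      by_contra! hcon
      exact hne (hf y hcon)
    simp only [mem_iUnion]
    -- Rounding each coordinate to the nearest integer finds the cell; in the square `[-1, 1]²` only
    -- `-1`, `0`, `1` occur.
    refine ⟨fun i => ⌊y i + 1 / 2⌋, ?_, y - intVec fun i => ⌊y i + 1 / 2⌋, ?_, by simp⟩
    · rw [nearShifts, Fintype.mem_piFinset]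
      intro i
      obtain ⟨h1, h2⟩ := abs_le.mp (hle i)
      rw [Finset.mem_Icc]
      constructor
      · rw [Int.le_floor]; push_cast; linarith
      · rw [← Int.lt_add_one_iff, Int.floor_lt]; push_cast; linarith
    · intro i
      have h1 := Int.floor_le (y i + 1 / 2)
      have h2 := Int.lt_floor_add_one (y i + 1 / 2)
      simp only [PiLp.sub_apply, intVec_apply, mem_Ico]
      constructor <;> linarith
  rw [← setIntegral_eq_integral_of_forall_compl_eq_zero hzero,
    integral_biUnion_finset _ (fun k _ => hT k) hdisj hon]
  exact Finset.sum_congr rfl fun k _ => ((hmp k).integral_comp (hemb k) f).symm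

/-- The shift to each cell leaves the periodic factor unchanged, so only `f` is periodized. This
turns weak identities tested on the plane into identities on one cell. -/
theorem integral_smul_periodic {f : Plane → ℝ} (hf : Continuous f)
    (hf0 : ∀ y, (∃ i, 1 < |y i|) → f y = 0) {P : Plane → F}
    (hP : Integrable P (volume.restrict unitCell)) (hper : ∀ k y, P (y + intVec k) = P y) :
    ∫ y, f y • P y = ∫ y in unitCell, (∑ k ∈ nearShifts, f (y + intVec k)) • P y := by
  have hsupp : HasCompactSupport f := by
    refine HasCompactSupport.of_support_subset_isCompact isCompact_square fun y hy i => ?_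
    by_contra! hcon
    exact hy (hf0 y ⟨i, hcon⟩)
  obtain ⟨C, hC⟩ := hf.bounded_above_of_compact_support hsupp
  have hint : ∀ k, Integrable (fun y => f (y + intVec k) • P y) (volume.restrict unitCell) := by
    intro k
    refine hP.bdd_smul (C := C) ?_ (Filter.Eventually.of_forall fun y => hC _)
    exact (hf.comp (continuous_id.add continuous_const)).aestronglyMeasurable
  rw [integral_eq_sum_unitCell (f := fun y => f y • P y)
    (fun y hy => by rw [hf0 y hy, zero_smul]) (fun k => by simpa only [hper] using hint k)]
  simp only [hper, Finset.sum_smul]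
  rw [integral_finsetSum _ fun k _ => hint k]

theorem integral_comp_act {A : Mat} (f : Plane → F) (hA : A.det ≠ 0) :
    ∫ y, f (act A y) = |A.det⁻¹| • ∫ x, f x := by
  have hemb : MeasurableEmbedding (act A) := (actEquiv hA).toHomeomorph.measurableEmbedding
  have h1 := Measure.map_linearMap_addHaar_eq_smul_addHaar volume
    (f := (act A : Plane →ₗ[ℝ] Plane)) (by rwa [det_act])
  rw [det_act] at h1
  have h2 : Measure.map (act A) volume = ENNReal.ofReal |A.det⁻¹| • volume := h1
  rw [← hemb.integral_map, h2, integral_smul_measure, ENNReal.toReal_ofReal (abs_nonneg _)]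

/-- Integration by parts on the cell of a lattice, against periodic test functions. -/
theorem IsSobolev.integral_unitCell {M : Mat} (hM : M.det ≠ 0) {p : ℝ≥0∞} (hp : 1 ≤ p)
    {v : Fin 2 → Plane → Plane} {G : Fin 2 → Plane → Plane →L[ℝ] Plane}
    (h : IsSobolev M p v G) (j : Fin 2) {w : Plane → ℝ} (hw : ContDiff ℝ (⊤ : ℕ∞) w)
    (hper : ∀ k y, w (y + intVec k) = w y) (η : Plane) :
    ∫ y in unitCell, fderiv ℝ w y η • v j (act M y) =
      -∫ y in unitCell, w y • G j (act M y) (act M η) := by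
  -- Weak gradients are tested with compactly supported functions. The partition of unity cuts `w`
  -- off in such a way that periodizing the product returns `w` on the cell.
  set ψ : Plane → ℝ := fun y => w y * planeBump y with hψ
  have hψd : ContDiff ℝ (⊤ : ℕ∞) ψ := hw.mul contDiff_planeBump
  have hψ0 : ∀ y, (∃ i, 1 < |y i|) → ψ y = 0 := fun y ⟨i, hi⟩ => by
    rw [hψ]; simp only; rw [planeBump_eq_zero ⟨i, hi.le⟩, mul_zero]
  have hψc : HasCompactSupport ψ := by
    refine HasCompactSupport.of_support_subset_isCompact isCompact_square fun y hy i => ?_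
    by_contra! hcon
    exact hy (hψ0 y ⟨i, hcon⟩)
  have hdiff : Differentiable ℝ ψ := hψd.differentiable (by simp)
  have hsum : ∀ y : Plane, (∀ i, |y i| < 1) → ∑ k ∈ nearShifts, ψ (y + intVec k) = w y := by
    intro y hy
    simp only [hψ, hper, ← Finset.mul_sum, sum_planeBump hy, mul_one]
  have hcell : ∀ y ∈ unitCell, ∀ i, |y i| < 1 := fun y hy i => by
    rw [abs_lt]; constructor <;> linarith [(hy i).1, (hy i).2]
  have hsum' : ∀ y ∈ unitCell, ∑ k ∈ nearShifts, fderiv ℝ ψ (y + intVec k) η =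
      fderiv ℝ w y η := by
    intro y hy
    have hopen : IsOpen {y : Plane | ∀ i, |y i| < 1} := by
      simp only [ofPred_forall]
      exact isOpen_iInter_of_finite fun i => isOpen_lt (by fun_prop) continuous_const
    -- The periodization agrees with `w` on an open square around the cell, so the derivatives agree
    -- as well.
    have hev : (fun z => ∑ k ∈ nearShifts, ψ (z + intVec k)) =ᶠ[nhds y] w := by
      filter_upwards [hopen.mem_nhds (hcell y hy)] with z hz
      exact hsum z hz
    rw [← hev.fderiv_eq, fderiv_fun_sum fun k _ => by
      exact (hdiff _).comp _ (differentiableAt_id.add_const _)]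
    simp only [sum_apply]
    exact Finset.sum_congr rfl fun k _ => by rw [fderiv_comp_add_right]
  have hlat : ∀ k, act M (intVec k) ∈ lattice M := act_intVec_mem M
  have hv := (memLp_comp_act hM (h.memLp j)).integrable hp
  have hG := (memLp_comp_act hM (h.memLp_grad j)).integrable hp
  have hG' : Integrable (fun y => G j (act M y) (act M η)) (volume.restrict unitCell) :=
    hG.apply_continuousLinearMap _
  -- The test function in physical coordinates; the Jacobian `|det M|⁻¹` appears on both sides
  -- below.
  set φ : Plane → ℝ := fun x => ψ (act M⁻¹ x) with hφ
  have hφd : ContDiff ℝ (⊤ : ℕ∞) φ := hψd.comp (act M⁻¹).contDiff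
  have hφc : HasCompactSupport φ :=
    hψc.comp_homeomorph (actEquiv hM).symm.toHomeomorph
  have hφM : ∀ y, φ (act M y) = ψ y := fun y => by rw [hφ]; simp only [act_inv_act hM]
  have hφ' : ∀ y, fderiv ℝ φ (act M y) (act M η) = fderiv ℝ ψ y η := by
    intro y
    have h1 : HasFDerivAt (fun z => φ (act M z)) ((fderiv ℝ φ (act M y)).comp (act M)) y :=
      ((hφd.differentiable (by simp)) _).hasFDerivAt.comp y (act M).hasFDerivAt
    simp only [hφM] at h1
    rw [h1.fderiv]
    rfl
  have key := congrArg (fun z => |M.det⁻¹| • z) (h.weak_grad j φ hφd hφc (act M η))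
  simp only [smul_neg] at key
  rw [← integral_comp_act _ hM, ← integral_comp_act _ hM] at key
  simp only [hφM, hφ'] at key
  rw [integral_smul_periodic ((hψd.continuous_fderiv (by simp)).clm_apply continuous_const) ?_ hv ?_,
    integral_smul_periodic hψd.continuous hψ0 hG' ?_] at key
  · refine Eq.trans (setIntegral_congr_fun measurableSet_unitCell fun y hy => ?_) (key.trans ?_)
    · simp only [hsum' y hy]
    · congr 1
      refine setIntegral_congr_fun measurableSet_unitCell fun y hy => ?_
      simp only [hsum y (hcell y hy)]
  · intro k y
    rw [map_add, h.periodic_grad j _ (hlat k)]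
  · rintro y ⟨i, hi⟩
    have hev : ψ =ᶠ[nhds y] fun _ => 0 := by
      have hopen : IsOpen {y : Plane | 1 < |y i|} := isOpen_lt continuous_const (by fun_prop)
      filter_upwards [hopen.mem_nhds hi] with z hz
      exact hψ0 z ⟨i, hz⟩
    rw [hev.fderiv_eq]
    simp
  · intro k y
    rw [map_add, h.periodic j _ (hlat k)]

end Moire
end

noncomputable section

namespace Moire

/-! ### Quadratic forms of gradients -/

/-- The phase `2π k · y` as a linear functional. -/
def phaseCLM (k : Fin 2 → ℤ) : Plane →L[ℝ] ℝ :=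
  (2 * Real.pi) • ∑ i, (k i : ℝ) • EuclideanSpace.proj (𝕜 := ℝ) i

theorem phaseCLM_apply (k : Fin 2 → ℤ) (y : Plane) : phaseCLM k y = phase k y := by
  simp [phaseCLM, phase, Fin.sum_univ_two, mul_add]

theorem hasFDerivAt_phase (k : Fin 2 → ℤ) (y : Plane) :
    HasFDerivAt (phase k) (phaseCLM k) y := by
  have : phase k = phaseCLM k := funext fun y => (phaseCLM_apply k y).symm
  rw [this]
  exact (phaseCLM k).hasFDerivAt

theorem contDiff_phase (k : Fin 2 → ℤ) : ContDiff ℝ (⊤ : ℕ∞) (phase k) := by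
  have : phase k = phaseCLM k := funext fun y => (phaseCLM_apply k y).symm
  rw [this]
  exact (phaseCLM k).contDiff

theorem phase_add_intVec (k l : Fin 2 → ℤ) (y : Plane) :
    phase k (y + intVec l) = phase k y + (∑ i, k i * l i : ℤ) * (2 * Real.pi) := by
  simp [phase, Fin.sum_univ_two]
  ring

/-- The coefficients of the gradient of a periodic function are of rank one. -/
theorem IsSobolev.cosCoeff_grad {M : Mat} (hM : M.det ≠ 0) {p : ℝ≥0∞} (hp : 1 ≤ p)
    {v : Fin 2 → Plane → Plane} {G : Fin 2 → Plane → Plane →L[ℝ] Plane}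
    (h : IsSobolev M p v G) (j : Fin 2) (k : Fin 2 → ℤ) :
    cosCoeff (fun y => G j (act M y)) k =
      ((phaseCLM k).comp (act M⁻¹)).smulRight (sinCoeff (fun y => v j (act M y)) k) := by
  have hG := (memLp_comp_act hM (h.memLp_grad j)).integrable hp
  ext1 e
  -- The direction `M⁻¹ e` in lattice coordinates is the direction `e` in the plane.
  have h1 := h.integral_unitCell hM hp j (w := fun y => Real.cos (phase k y))
    (Real.contDiff_cos.comp (contDiff_phase k))
    (fun l y => by rw [phase_add_intVec, Real.cos_add_int_mul_two_pi]) (act M⁻¹ e)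
  have h2 : ∀ y, fderiv ℝ (fun y => Real.cos (phase k y)) y (act M⁻¹ e) =
      -(Real.sin (phase k y) * phase k (act M⁻¹ e)) := fun y => by
    rw [(hasFDerivAt_phase k y).cos.fderiv]
    simp [phaseCLM_apply]
  simp only [h2, act_act_inv hM, neg_smul, integral_neg, neg_inj] at h1
  rw [cosCoeff, ContinuousLinearMap.integral_apply (integrable_cos_smul hG k)]
  simp only [smul_apply]
  rw [← h1, ContinuousLinearMap.smulRight_apply, sinCoeff, ← integral_smul]
  simp [phaseCLM_apply, smul_smul, mul_comm]

theorem IsSobolev.sinCoeff_grad {M : Mat} (hM : M.det ≠ 0) {p : ℝ≥0∞} (hp : 1 ≤ p)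
    {v : Fin 2 → Plane → Plane} {G : Fin 2 → Plane → Plane →L[ℝ] Plane}
    (h : IsSobolev M p v G) (j : Fin 2) (k : Fin 2 → ℤ) :
    sinCoeff (fun y => G j (act M y)) k =
      ((phaseCLM k).comp (act M⁻¹)).smulRight (-cosCoeff (fun y => v j (act M y)) k) := by
  have hG := (memLp_comp_act hM (h.memLp_grad j)).integrable hp
  ext1 e
  have h1 := h.integral_unitCell hM hp j (w := fun y => Real.sin (phase k y))
    (Real.contDiff_sin.comp (contDiff_phase k))
    (fun l y => by rw [phase_add_intVec, Real.sin_add_int_mul_two_pi]) (act M⁻¹ e)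
  have h2 : ∀ y, fderiv ℝ (fun y => Real.sin (phase k y)) y (act M⁻¹ e) =
      Real.cos (phase k y) * phase k (act M⁻¹ e) := fun y => by
    rw [(hasFDerivAt_phase k y).sin.fderiv]
    simp [phaseCLM_apply]
  simp only [h2, act_act_inv hM] at h1
  rw [sinCoeff, ContinuousLinearMap.integral_apply (integrable_sin_smul hG k)]
  simp only [smul_apply]
  rw [← neg_eq_iff_eq_neg.mpr h1, ContinuousLinearMap.smulRight_apply, cosCoeff, smul_neg,
    ← integral_smul]
  simp [phaseCLM_apply, smul_smul, mul_comm]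

/-- The matrix entry `(p.1, p.2)` of a linear map. -/
def entry (p : Fin 2 × Fin 2) : (Plane →L[ℝ] Plane) →L[ℝ] ℝ :=
  (EuclideanSpace.proj (𝕜 := ℝ) p.1).comp
    (ContinuousLinearMap.apply ℝ Plane (EuclideanSpace.single p.2 1))

/-- The linear map with a single matrix entry. -/
def unitMap (p : Fin 2 × Fin 2) : Plane →L[ℝ] Plane :=
  (EuclideanSpace.proj (𝕜 := ℝ) p.2).smulRight (EuclideanSpace.single p.1 1)

theorem entry_apply (p : Fin 2 × Fin 2) (T : Plane →L[ℝ] Plane) :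
    entry p T = T (EuclideanSpace.single p.2 1) p.1 := rfl

theorem eq_sum_single (x : Plane) :
    x = ∑ i, x i • (EuclideanSpace.single i 1 : Plane) := by
  ext i
  fin_cases i <;> simp [Fin.sum_univ_two]

theorem eq_sum_entry (T : Plane →L[ℝ] Plane) : T = ∑ p, entry p T • unitMap p := by
  ext1 x
  conv_lhs => rw [eq_sum_single x]
  rw [map_sum, sum_apply, Fintype.sum_prod_type_right]
  refine Finset.sum_congr rfl fun i _ => ?_
  rw [map_smul]
  conv_lhs => rw [eq_sum_single (T (EuclideanSpace.single i 1))]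
  rw [Finset.smul_sum]
  refine Finset.sum_congr rfl fun l _ => ?_
  simp [entry_apply, unitMap, smul_smul, mul_comm]

abbrev MapForm := (Plane →L[ℝ] Plane) →L[ℝ] (Plane →L[ℝ] Plane) →L[ℝ] ℝ

/-- Expansion in matrix entries, which reduces Parseval's identity for forms to the scalar identity
for pairs of entries. -/
theorem mapForm_apply (R : MapForm) (T : Plane →L[ℝ] Plane) :
    R T T = ∑ p, ∑ q, (entry p T * entry q T) * R (unitMap p) (unitMap q) := by
  conv_lhs => rw [eq_sum_entry T]
  simp only [map_sum, sum_apply, map_smul, smul_apply, smul_eq_mul]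
  rw [Finset.sum_comm]
  refine Finset.sum_congr rfl fun p _ => ?_
  rw [Finset.mul_sum]
  refine Finset.sum_congr rfl fun q _ => ?_
  ring

/-- Parseval's identity for quadratic forms. -/
theorem hasSum_mapForm (R : MapForm) {g : Plane → Plane →L[ℝ] Plane}
    (hg : MemLp g 2 (volume.restrict unitCell)) :
    HasSum (fun k => R (cosCoeff g k) (cosCoeff g k) + R (sinCoeff g k) (sinCoeff g k))
      (∫ y in unitCell, R (g y) (g y)) := by
  have hi : Integrable g (volume.restrict unitCell) := hg.integrable (by norm_num)
  have hent : ∀ p, MemLp (fun y => entry p (g y)) 2 (volume.restrict unitCell) := fun p =>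
    (entry p).comp_memLp' hg
  have hc : ∀ p k, entry p (cosCoeff g k) = cosCoeff (fun y => entry p (g y)) k := fun p k => by
    rw [cosCoeff, ← (entry p).integral_comp_comm (integrable_cos_smul hi k)]
    simp [cosCoeff]
  have hs : ∀ p k, entry p (sinCoeff g k) = sinCoeff (fun y => entry p (g y)) k := fun p k => by
    rw [sinCoeff, ← (entry p).integral_comp_comm (integrable_sin_smul hi k)]
    simp [sinCoeff]
  have hint : ∀ p q, Integrable (fun y => entry p (g y) * entry q (g y) *
      R (unitMap p) (unitMap q)) (volume.restrict unitCell) := fun p q =>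
    ((hent p).integrable_mul (hent q)).mul_const _
  have h1 : ∫ y in unitCell, R (g y) (g y) = ∑ p, ∑ q,
      (∫ y in unitCell, entry p (g y) * entry q (g y)) * R (unitMap p) (unitMap q) := by
    simp only [mapForm_apply R (g _)]
    rw [integral_finsetSum _ fun p _ => integrable_finsetSum _ fun q _ => hint p q]
    refine Finset.sum_congr rfl fun p _ => ?_
    rw [integral_finsetSum _ fun q _ => hint p q]
    exact Finset.sum_congr rfl fun q _ => integral_mul_const _ _
  rw [h1]
  have h2 := hasSum_sum fun p (_ : p ∈ Finset.univ) => hasSum_sum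
    fun q (_ : q ∈ Finset.univ) =>
      (hasSum_cosCoeff_mul_add_sinCoeff_mul (hent p) (hent q)).mul_right
        (R (unitMap p) (unitMap q))
  convert! h2 using 1
  ext k
  rw [mapForm_apply R (cosCoeff g k), mapForm_apply R (sinCoeff g k)]
  simp only [hc, hs, add_mul, Finset.sum_add_distrib]

/-- A quadratic form which is nonnegative on matrices of rank one has a nonnegative average over
the gradient of a periodic function. -/
theorem IsSobolev.average_mapForm_nonneg {M : Mat} (hM : M.det ≠ 0)
    {v : Fin 2 → Plane → Plane} {G : Fin 2 → Plane → Plane →L[ℝ] Plane}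
    (h : IsSobolev M 2 v G) (j : Fin 2) (R : MapForm)
    (hR : ∀ (l : Plane →L[ℝ] ℝ) (a : Plane), 0 ≤ R (l.smulRight a) (l.smulRight a)) :
    0 ≤ ⨍ x in cell M, R (G j x) (G j x) := by
  rw [average_cell hM]
  -- Every term of the Parseval series is the form evaluated at rank-one matrices.
  refine (hasSum_mapForm R (memLp_comp_act hM (h.memLp_grad j))).nonneg fun k => ?_
  rw [h.cosCoeff_grad hM (by norm_num), h.sinCoeff_grad hM (by norm_num)]
  exact add_nonneg (hR _ _) (hR _ _)

end Moire
end

noncomputable section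

namespace Moire

/-! ### Second differentials -/

open Filter Topology in
-- Chain rule twice; as the inner map is linear, no term with its second derivative arises.
theorem fderiv_fderiv_comp_clm {E E' : Type*} [NormedAddCommGroup E] [NormedSpace ℝ E]
    [NormedAddCommGroup E'] [NormedSpace ℝ E'] {Φ : E → ℝ} (L : E' →L[ℝ] E) {x : E'}
    (hΦ : ContDiffAt ℝ 2 Φ (L x)) (h k : E') :
    fderiv ℝ (fderiv ℝ (fun y => Φ (L y))) x h k =
      fderiv ℝ (fderiv ℝ Φ) (L x) (L h) (L k) := by
  have h1 : ∀ᶠ y in 𝓝 (L x), DifferentiableAt ℝ Φ y := by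
    filter_upwards [hΦ.eventually (by simp)] with y hy
    exact hy.differentiableAt (by norm_num)
  have h2 : fderiv ℝ (fun y => Φ (L y)) =ᶠ[𝓝 x]
      fun y => (ContinuousLinearMap.compL ℝ E' E ℝ).flip L (fderiv ℝ Φ (L y)) := by
    filter_upwards [L.continuous.continuousAt.eventually h1] with y hy
    exact (hy.hasFDerivAt.comp y L.hasFDerivAt).fderiv
  have h3 : DifferentiableAt ℝ (fderiv ℝ Φ) (L x) :=
    (hΦ.fderiv_right (m := 1) (by norm_num)).differentiableAt (by norm_num)
  rw [h2.fderiv_eq]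
  have h4 := (((ContinuousLinearMap.compL ℝ E' E ℝ).flip L).hasFDerivAt.comp x
    (h3.hasFDerivAt.comp x L.hasFDerivAt)).fderiv
  change fderiv ℝ (⇑((ContinuousLinearMap.compL ℝ E' E ℝ).flip L) ∘ fderiv ℝ Φ ∘ ⇑L) x h k = _
  rw [h4]
  rfl

open Filter Topology in
/-- Second derivative at `0` of the integral of a `C²` function along a bounded field of rays. -/
theorem iteratedDeriv_two_integral {E : Type*} [NormedAddCommGroup E] [NormedSpace ℝ E]
    {Φ : E → ℝ} (hΦ : ContDiffAt ℝ 2 Φ 0) {μ : Measure Plane} [IsFiniteMeasure μ]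
    {X : Plane → E} (hX : Continuous X) {C : ℝ} (hC : ∀ y, ‖X y‖ ≤ C) :
    iteratedDeriv 2 (fun t : ℝ => ∫ y, Φ (t • X y) ∂μ) 0 =
      ∫ y, fderiv ℝ (fderiv ℝ Φ) 0 (X y) (X y) ∂μ := by
  have hC0 : 0 ≤ C := (norm_nonneg _).trans (hC 0)
  have hΦ1 : ContDiffAt ℝ 1 (fderiv ℝ Φ) 0 := hΦ.fderiv_right (by norm_num)
  have hΦ2 : ContDiffAt ℝ 0 (fderiv ℝ (fderiv ℝ Φ)) 0 := hΦ1.fderiv_right (by norm_num)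
  have hn : ContinuousAt (fun x => ‖fderiv ℝ (fderiv ℝ Φ) x‖) 0 :=
    ContinuousAt.norm (E := E →L[ℝ] E →L[ℝ] ℝ) hΦ2.continuousAt
  -- Continuity at `0` bounds both derivatives on a ball; these bounds dominate the differentiation
  -- under the integral.
  have hev : ∀ᶠ x in 𝓝 (0 : E), ContDiffAt ℝ 2 Φ x ∧
      ‖fderiv ℝ Φ x‖ < ‖fderiv ℝ Φ 0‖ + 1 ∧
      ‖fderiv ℝ (fderiv ℝ Φ) x‖ < ‖fderiv ℝ (fderiv ℝ Φ) 0‖ + 1 :=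
    (hΦ.eventually (by simp)).and
      ((hΦ1.continuousAt.norm.eventually_lt_const (lt_add_one _)).and
        (hn.eventually_lt_const (lt_add_one _)))
  obtain ⟨r, hr, hball⟩ := Metric.eventually_nhds_iff_ball.mp hev
  -- For `|t| < δ` the whole field of rays stays in that ball; `C + 1` avoids division by zero.
  set δ := r / (C + 1) with hδ
  have hδ0 : 0 < δ := by positivity
  have hin : ∀ t : ℝ, t ∈ Metric.ball (0 : ℝ) δ → ∀ y, t • X y ∈ Metric.ball (0 : E) r := by
    intro t ht y
    rw [mem_ball_zero_iff, Real.norm_eq_abs] at ht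
    rw [mem_ball_zero_iff, norm_smul, Real.norm_eq_abs]
    calc |t| * ‖X y‖ ≤ |t| * (C + 1) := by gcongr; linarith [hC y]
      _ < δ * (C + 1) := by gcongr
      _ = r := by rw [hδ]; field_simp
  have hcd : ∀ t ∈ Metric.ball (0 : ℝ) δ, ∀ y, ContDiffAt ℝ 2 Φ (t • X y) := fun t ht y =>
    (hball _ (hin t ht y)).1
  have hcd1 : ∀ t ∈ Metric.ball (0 : ℝ) δ, ∀ y, ContDiffAt ℝ 1 (fderiv ℝ Φ) (t • X y) :=
    fun t ht y => (hcd t ht y).fderiv_right (by norm_num)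
  have hcd2 : ∀ t ∈ Metric.ball (0 : ℝ) δ, ∀ y,
      ContDiffAt ℝ 0 (fderiv ℝ (fderiv ℝ Φ)) (t • X y) :=
    fun t ht y => (hcd1 t ht y).fderiv_right (by norm_num)
  have hray : ∀ (t : ℝ) y, HasDerivAt (fun t : ℝ => t • X y) (X y) t := fun t y => by
    simpa using (hasDerivAt_id t).smul_const (X y)
  have hcont : ∀ t : ℝ, Continuous fun y => t • X y := fun t => hX.const_smul t
  have c0 : ∀ t ∈ Metric.ball (0 : ℝ) δ, Continuous fun y => Φ (t • X y) := fun t ht =>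
    continuous_iff_continuousAt.mpr fun y =>
      ContinuousAt.comp (g := Φ) (hcd t ht y).continuousAt (hcont t).continuousAt
  have c1 : ∀ t ∈ Metric.ball (0 : ℝ) δ, Continuous fun y => fderiv ℝ Φ (t • X y) (X y) :=
    fun t ht => Continuous.clm_apply (continuous_iff_continuousAt.mpr fun y =>
      ContinuousAt.comp (g := fderiv ℝ Φ) (hcd1 t ht y).continuousAt
        (hcont t).continuousAt) hX
  have c2 : ∀ t ∈ Metric.ball (0 : ℝ) δ, Continuous fun y =>
      fderiv ℝ (fderiv ℝ Φ) (t • X y) (X y) (X y) :=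
    fun t ht => Continuous.clm_apply (Continuous.clm_apply (continuous_iff_continuousAt.mpr
      fun y => ContinuousAt.comp (g := fderiv ℝ (fderiv ℝ Φ)) (hcd2 t ht y).continuousAt
        (hcont t).continuousAt) hX) hX
  have b1 : ∀ t ∈ Metric.ball (0 : ℝ) δ, ∀ y, ‖fderiv ℝ Φ (t • X y) (X y)‖ ≤
      (‖fderiv ℝ Φ 0‖ + 1) * C := fun t ht y =>
    (ContinuousLinearMap.le_opNorm _ _).trans
      (mul_le_mul (hball _ (hin t ht y)).2.1.le (hC y) (norm_nonneg _) (by positivity))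
  have b2 : ∀ t ∈ Metric.ball (0 : ℝ) δ, ∀ y,
      ‖fderiv ℝ (fderiv ℝ Φ) (t • X y) (X y) (X y)‖ ≤
      (‖fderiv ℝ (fderiv ℝ Φ) 0‖ + 1) * C * C := fun t ht y =>
    (ContinuousLinearMap.le_opNorm₂ _ _ _).trans (by
      have := (hball _ (hin t ht y)).2.2.le
      have := hC y
      gcongr)
  have h0mem : (0 : ℝ) ∈ Metric.ball (0 : ℝ) δ := Metric.mem_ball_self hδ0
  have hbdd : ∀ {f : Plane → ℝ} {K : ℝ}, Continuous f → (∀ y, ‖f y‖ ≤ K) → Integrable f μ :=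
    fun hf hK => Integrable.of_bound hf.aestronglyMeasurable _ (Eventually.of_forall hK)
  have d1 : ∀ t ∈ Metric.ball (0 : ℝ) δ, ∀ y,
      HasDerivAt (fun t : ℝ => Φ (t • X y)) (fderiv ℝ Φ (t • X y) (X y)) t := fun t ht y =>
    ((hcd t ht y).differentiableAt (by norm_num)).hasFDerivAt.comp_hasDerivAt t (hray t y)
  have d2 : ∀ t ∈ Metric.ball (0 : ℝ) δ, ∀ y,
      HasDerivAt (fun t : ℝ => fderiv ℝ Φ (t • X y) (X y))
        (fderiv ℝ (fderiv ℝ Φ) (t • X y) (X y) (X y)) t := fun t ht y => by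
    have h1 := ((hcd1 t ht y).differentiableAt (by norm_num)).hasFDerivAt.comp_hasDerivAt t
      (hray t y)
    simpa using h1.clm_apply (hasDerivAt_const t (X y))
  have i0 : ∀ t ∈ Metric.ball (0 : ℝ) δ, Integrable (fun y => Φ (t • X y)) μ := by
    intro t ht
    refine hbdd (K := |Φ 0| + (‖fderiv ℝ Φ 0‖ + 1) * r) (c0 t ht) fun y => ?_
    have h1 : ‖Φ (t • X y) - Φ 0‖ ≤ (‖fderiv ℝ Φ 0‖ + 1) * ‖t • X y - 0‖ :=
      (convex_ball (0 : E) r).norm_image_sub_le_of_norm_fderiv_le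
        (fun x hx => ((hball x hx).1.differentiableAt (by norm_num)))
        (fun x hx => (hball x hx).2.1.le) (Metric.mem_ball_self hr) (hin t ht y)
    have h2 : ‖t • X y - 0‖ ≤ r := by
      rw [sub_zero]
      exact (mem_ball_zero_iff.mp (hin t ht y)).le
    calc ‖Φ (t • X y)‖ ≤ ‖Φ 0‖ + ‖Φ (t • X y) - Φ 0‖ := norm_le_insert' _ _
      _ ≤ |Φ 0| + (‖fderiv ℝ Φ 0‖ + 1) * r := by
        refine add_le_add le_rfl (h1.trans ?_)
        gcongr
  have e1 : ∀ t ∈ Metric.ball (0 : ℝ) δ, HasDerivAt (fun t : ℝ => ∫ y, Φ (t • X y) ∂μ)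
      (∫ y, fderiv ℝ Φ (t • X y) (X y) ∂μ) t := by
    intro t ht
    have hnb := Metric.isOpen_ball.mem_nhds ht
    exact (hasDerivAt_integral_of_dominated_loc_of_deriv_le hnb
      (by filter_upwards [hnb] with s hs using (c0 s hs).aestronglyMeasurable) (i0 t ht)
      (c1 t ht).aestronglyMeasurable (Eventually.of_forall fun y s hs => b1 s hs y)
      (integrable_const _) (Eventually.of_forall fun y s hs => d1 s hs y)).2
  have e2 : HasDerivAt (fun t : ℝ => ∫ y, fderiv ℝ Φ (t • X y) (X y) ∂μ)
      (∫ y, fderiv ℝ (fderiv ℝ Φ) ((0 : ℝ) • X y) (X y) (X y) ∂μ) 0 := by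
    have hnb := Metric.isOpen_ball.mem_nhds h0mem
    exact (hasDerivAt_integral_of_dominated_loc_of_deriv_le hnb
      (by filter_upwards [hnb] with s hs using (c1 s hs).aestronglyMeasurable)
      (hbdd (c1 0 h0mem) (b1 0 h0mem))
      (c2 0 h0mem).aestronglyMeasurable (Eventually.of_forall fun y s hs => b2 s hs y)
      (integrable_const _) (Eventually.of_forall fun y s hs => d2 s hs y)).2
  -- The second derivative at `0` needs the first derivative in a whole neighbourhood of `0`.
  have e3 : deriv (fun t : ℝ => ∫ y, Φ (t • X y) ∂μ) =ᶠ[𝓝 0]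
      fun t : ℝ => ∫ y, fderiv ℝ Φ (t • X y) (X y) ∂μ := by
    filter_upwards [Metric.isOpen_ball.mem_nhds h0mem] with t ht using (e1 t ht).deriv
  rw [iteratedDeriv_succ, iteratedDeriv_one, e3.deriv_eq, e2.deriv]
  simp only [zero_smul]

/-! ### The Hessian of a site potential -/

/-- The potential as a function on the Banach space of stencils. -/
def potential {A : Mat} (V : (Bond A → Plane) → ℝ) (x : Stencil A) : ℝ := V (stencilFamily x)

theorem hessian_eq {A : Mat} (V : (Bond A → Plane) → ℝ) (h k : Stencil A) :
    hessian V h k = fderiv ℝ (fderiv ℝ (potential V)) 0 h k := by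
  rw [hessian, iteratedFDeriv_two_apply]
  rfl

theorem IsSitePotential.contDiffAt {A : Mat} {κ₀ : ℝ} {V : (Bond A → Plane) → ℝ}
    (hV : IsSitePotential A κ₀ V) {x : Stencil A} (hx : ‖x‖ < κ₀) :
    ContDiffAt ℝ 2 (potential V) x :=
  hV.contDiffOn.contDiffAt (Metric.isOpen_ball.mem_nhds (mem_ball_zero_iff.mpr hx))

theorem continuous_single {A : Mat} [DecidableEq (Bond A)] (τ : Bond A) :
    Continuous fun a : Plane => (lp.single ⊤ τ a : Stencil A) :=
  AddMonoidHomClass.continuous_of_bound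
    (lp.singleAddMonoidHom (E := fun _ : Bond A => Plane) ⊤ τ) 1 fun a => by
      rw [one_mul]
      exact (lp.norm_single (E := fun _ : Bond A => Plane) ENNReal.zero_lt_top τ a).le

theorem continuous_bondHessian {A : Mat} (V : (Bond A → Plane) → ℝ) (ρ σ : Bond A) :
    Continuous fun q : Plane × Plane => bondHessian V ρ σ q.1 q.2 := by
  simp only [bondHessian, hessian_eq]
  exact (((fderiv ℝ (fderiv ℝ (potential V)) 0).continuous.comp
    ((continuous_single ρ).comp continuous_fst))).clm_apply
      ((continuous_single σ).comp continuous_snd)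

open Filter Topology in
-- Dominated convergence for the double sum. Pointwise convergence is the right notion: rescaled
-- difference stencils of long waves converge bond by bond, but not uniformly over long bonds. This
-- is where the second moment bound enters.
theorem tendsto_tsum_bilinear {ι : Type*} {b : ι → ι → Plane → Plane → ℝ} {m : ι × ι → ℝ}
    (hm : Summable m) (hcont : ∀ ρ σ, Continuous fun q : Plane × Plane => b ρ σ q.1 q.2)
    (hb : ∀ ρ σ x y, |b ρ σ x y| ≤ m (ρ, σ) * (‖x‖ * ‖y‖)) {Y : ℕ → ι → Plane} {Z : ι → Plane}
    {C : ℝ} (hC : ∀ n ρ, ‖Y n ρ‖ ≤ C) (hlim : ∀ ρ, Tendsto (fun n => Y n ρ) atTop (𝓝 (Z ρ))) :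
    Tendsto (fun n => ∑' q : ι × ι, b q.1 q.2 (Y n q.1) (Y n q.2)) atTop
      (𝓝 (∑' q : ι × ι, b q.1 q.2 (Z q.1) (Z q.2))) := by
  refine tendsto_tsum_of_dominated_convergence (bound := fun q => |m q| * (C * C))
    (hm.abs.mul_right _) (fun q => ?_) (Eventually.of_forall fun n q => ?_)
  · exact ((hcont q.1 q.2).tendsto (Z q.1, Z q.2)).comp ((hlim q.1).prodMk_nhds (hlim q.2))
  · refine (hb q.1 q.2 _ _).trans ?_
    have h0 : 0 ≤ C := (norm_nonneg _).trans (hC n q.1)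
    have := hC n q.1
    have := hC n q.2
    gcongr
    exact le_abs_self _

open Filter Topology in
/-- The second differential is continuous under bounded pointwise convergence of stencils. -/
theorem IsSitePotential.tendsto_hessian {A : Mat} {κ₀ : ℝ} {V : (Bond A → Plane) → ℝ}
    (hV : IsSitePotential A κ₀ V) {Y : ℕ → Stencil A} {Z : Stencil A} {C : ℝ}
    (hC : ∀ n ρ, ‖Y n ρ‖ ≤ C) (hlim : ∀ ρ, Tendsto (fun n => Y n ρ) atTop (𝓝 (Z ρ))) :
    Tendsto (fun n => hessian V (Y n) (Y n)) atTop (𝓝 (hessian V Z Z)) := by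
  obtain ⟨m, hm, hb⟩ := hV.moment
  have h1 : ∀ x : Stencil A, hessian V x x =
      ∑' q : Bond A × Bond A, bondHessian V q.1 q.2 (x q.1) (x q.2) := fun x =>
    (hV.hasSum x x).tsum_eq.symm
  rw [funext fun n => h1 (Y n), h1 Z]
  exact tendsto_tsum_bilinear hm (continuous_bondHessian V) hb hC hlim

/-! ### The Cauchy–Born map -/

/-- The stencil of a homogeneous deformation. -/
def cbStencil (A : Mat) : (Plane →L[ℝ] Plane) →L[ℝ] Stencil A :=
  LinearMap.mkContinuous
    { toFun := fun T => ⟨fun ρ => ‖ρ.1‖⁻¹ • T ρ.1, memℓp_infty ⟨‖T‖, by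
        rintro _ ⟨ρ, rfl⟩
        simp only [norm_smul, norm_inv, norm_norm]
        rw [inv_mul_le_iff₀ (norm_pos_iff.mpr ρ.2.2), mul_comm]
        exact T.le_opNorm _⟩⟩
      map_add' := fun S T => by ext1; funext ρ; exact smul_add _ _ _
      map_smul' := fun c T => by ext1; funext ρ; exact smul_comm (‖ρ.1‖⁻¹) c (T ρ.1) }
    1 (fun T => by
      rw [one_mul]
      refine lp.norm_le_of_forall_le (norm_nonneg _) fun ρ => ?_
      change ‖‖ρ.1‖⁻¹ • T ρ.1‖ ≤ _
      rw [norm_smul, norm_inv, norm_norm, inv_mul_le_iff₀ (norm_pos_iff.mpr ρ.2.2), mul_comm]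
      exact T.le_opNorm _)

theorem cbStencil_apply (A : Mat) (T : Plane →L[ℝ] Plane) (ρ : Bond A) :
    cbStencil A T ρ = ‖ρ.1‖⁻¹ • T ρ.1 := rfl

theorem norm_cbStencil_le (A : Mat) (T : Plane →L[ℝ] Plane) : ‖cbStencil A T‖ ≤ ‖T‖ := by
  simpa using (cbStencil A).le_of_opNorm_le (LinearMap.mkContinuous_norm_le _ zero_le_one _) T

theorem cauchyBorn_eq {A : Mat} (V : (Bond A → Plane) → ℝ) :
    cauchyBorn V = fun T => potential V (cbStencil A T) := by
  funext T
  rw [cauchyBorn, potential]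
  congr 1
  funext ρ
  rw [stencilFamily, cbStencil_apply, smul_inv_smul₀ (norm_ne_zero_iff.mpr ρ.2.2)]

/-- The second differential of the Cauchy–Born energy density. -/
theorem IsSitePotential.iteratedFDeriv_cauchyBorn {A : Mat} {κ₀ : ℝ}
    {V : (Bond A → Plane) → ℝ} (hV : IsSitePotential A κ₀ V) {T : Plane →L[ℝ] Plane}
    (hT : ‖T‖ < κ₀) (S : Plane →L[ℝ] Plane) :
    iteratedFDeriv ℝ 2 (cauchyBorn V) T ![S, S] =
      fderiv ℝ (fderiv ℝ (potential V)) (cbStencil A T) (cbStencil A S) (cbStencil A S) := by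
  rw [iteratedFDeriv_two_apply, cauchyBorn_eq]
  exact fderiv_fderiv_comp_clm _ (hV.contDiffAt ((norm_cbStencil_le A T).trans_lt hT)) S S

end Moire
end

noncomputable section

namespace Moire

/-! ### The gradient of the interpolant -/

/-- The coordinates with respect to the columns of `A`. -/
def coord (A : Mat) (i : Fin 2) : Plane →L[ℝ] ℝ :=
  (EuclideanSpace.proj (𝕜 := ℝ) i).comp (act A⁻¹)

theorem coord_apply (A : Mat) (i : Fin 2) (x : Plane) : coord A i x = act A⁻¹ x i := rfl

theorem act_eq_sum (A : Mat) (x : Plane) :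
    act A x = ∑ i, x i • act A (EuclideanSpace.single i 1) := by
  conv_lhs => rw [eq_sum_single x]
  rw [map_sum]
  simp only [map_smul]

theorem eq_sum_coord {A : Mat} (hA : A.det ≠ 0) (x : Plane) :
    x = ∑ i, coord A i x • act A (EuclideanSpace.single i 1) := by
  conv_lhs => rw [← act_act_inv hA x]
  exact act_eq_sum A _

open Filter Topology in
-- Away from the boundary of a cell, a small shift does not change the integer part.
theorem eventually_fract_coord_sub {A : Mat} {α : Plane} {i : Fin 2}
    (h : Int.fract (coord A i α) ≠ 0) :
    ∀ᶠ x in 𝓝 (0 : Plane), Int.fract (coord A i (α - x)) =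
      Int.fract (coord A i α) - coord A i x := by
  have h0 : 0 < Int.fract (coord A i α) := (Int.fract_nonneg _).lt_of_ne' h
  have h1 := Int.fract_lt_one (coord A i α)
  have hc : ContinuousAt (fun x => Int.fract (coord A i α) - coord A i x) 0 := by fun_prop
  have e1 := hc.eventually (lt_mem_nhds (a := 0) (by simpa using h0))
  have e2 := hc.eventually_lt_const (u := 1) (by simpa using h1)
  filter_upwards [e1, e2] with x hx1 hx2
  rw [Int.fract_eq_iff]
  refine ⟨hx1.le, hx2, ⌊coord A i α⌋, ?_⟩
  rw [map_sub, Int.fract]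
  ring

theorem act_sub_coord {A : Mat} (hA : A.det ≠ 0) (s t : ℝ) (x : Plane) :
    act A !₂[s - coord A 0 x, t - coord A 1 x] = act A !₂[s, t] - x := by
  conv_rhs => rw [← act_act_inv hA x, ← map_sub]
  congr 1
  ext i
  fin_cases i <;> simp [coord_apply]

open Filter Topology in
/-- The gradient of the bilinear interpolant in the interior of an interpolation cell. -/
theorem interpolantGrad_eq {A : Mat} (hA : A.det ≠ 0) (v : Plane → Plane) {α : Plane} (β : Plane)
    (h : ∀ i, Int.fract (coord A i α) ≠ 0) (s t : ℝ) (hs : s = Int.fract (coord A 0 α))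
    (ht : t = Int.fract (coord A 1 α)) :
    interpolantGrad A v α β =
      -((coord A 0).smulRight
          ((1 - t) • (v (β - act A !₂[s - 1, t]) - v (β - act A !₂[s, t])) +
            t • (v (β - act A !₂[s - 1, t - 1]) - v (β - act A !₂[s, t - 1]))) +
        (coord A 1).smulRight
          ((1 - s) • (v (β - act A !₂[s, t - 1]) - v (β - act A !₂[s, t])) +
            s • (v (β - act A !₂[s - 1, t - 1]) - v (β - act A !₂[s - 1, t])))) := by
  set w00 := v (β - act A !₂[s, t])
  set w10 := v (β - act A !₂[s - 1, t])
  set w01 := v (β - act A !₂[s, t - 1])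
  set w11 := v (β - act A !₂[s - 1, t - 1])
  have hev : (fun x => interpolant A v (α - x) (β - x)) =ᶠ[𝓝 0] fun x =>
      ((1 - (s - coord A 0 x)) * (1 - (t - coord A 1 x))) • w00 +
      ((s - coord A 0 x) * (1 - (t - coord A 1 x))) • w10 +
      ((1 - (s - coord A 0 x)) * (t - coord A 1 x)) • w01 +
      ((s - coord A 0 x) * (t - coord A 1 x)) • w11 := by
    filter_upwards [eventually_fract_coord_sub (h 0), eventually_fract_coord_sub (h 1)]
      with x h0 h1
    rw [← hs] at h0
    rw [← ht] at h1
    -- Configuration and local coordinates move together, so the four site values do not depend on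
    -- `x`; only the bilinear weights are differentiated.
    have hx : ∀ s' t' : ℝ, β - x - act A !₂[s' - coord A 0 x, t' - coord A 1 x] =
        β - act A !₂[s', t'] := fun s' t' => by rw [act_sub_coord hA]; abel
    simp only [interpolant, ← coord_apply]
    rw [h0, h1, sub_right_comm s, sub_right_comm t, hx, hx, hx, hx]
  have c0 := (coord A 0).hasFDerivAt (x := 0)
  have c1 := (coord A 1).hasFDerivAt (x := 0)
  have s0 := c0.const_sub s
  have t0 := c1.const_sub t
  have s1 := s0.const_sub 1
  have t1 := t0.const_sub 1
  have hd := ((((s1.mul t1).smul_const w00).add ((s0.mul t1).smul_const w10)).add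
    ((s1.mul t0).smul_const w01)).add ((s0.mul t0).smul_const w11)
  rw [interpolantGrad, hev.fderiv_eq]
  refine hd.fderiv.trans ?_
  ext1 x
  simp
  module

/-- The exceptional set is the preimage of the countable set `ℤ` under a surjective linear
functional. -/
theorem ae_fract_coord_ne_zero {A : Mat} (hA : A.det ≠ 0) (i : Fin 2) :
    ∀ᵐ α : Plane, Int.fract (coord A i α) ≠ 0 := by
  have hsurj : Function.Surjective (coord A i : Plane →ₗ[ℝ] ℝ) := fun r =>
    ⟨act A (EuclideanSpace.single i r), by
      change act A⁻¹ (act A (EuclideanSpace.single i r)) i = r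
      rw [act_inv_act hA]; simp⟩
  have hms : MeasurableSet {r : ℝ | Int.fract r ≠ 0} :=
    (measurable_fract (measurableSet_singleton 0)).compl
  refine (ae_comp_linearMap_mem_iff (coord A i : Plane →ₗ[ℝ] ℝ) volume volume hsurj hms).mpr ?_
  have hnull : volume (range ((↑) : ℤ → ℝ)) = 0 := (countable_range _).measure_zero _
  filter_upwards [compl_mem_ae_iff.mpr hnull] with r hr h0
  exact hr ⟨⌊r⌋, by rw [← sub_eq_zero.mp (show r - ⌊r⌋ = 0 from h0)]⟩

/-! ### Plane waves -/

/-- The displacement `γ ↦ Re (c exp (i K γ)) a`. -/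
def wave (K : Plane →L[ℝ] ℝ) (a : Plane) (c : ℂ) (γ : Plane) : Plane :=
  (c * Complex.exp (K γ * Complex.I)).re • a

/-- The difference quotients of a plane wave over the interpolation cell, in the direction of the
first column, at height `t`. -/
def cellSlope (p q : ℝ) (t : ℝ) : ℂ :=
  (Complex.exp (p * Complex.I) - 1) * ((1 - t) + t * Complex.exp (q * Complex.I))

/-- The complex amplitude of the slope, in the direction `e`, of the interpolated plane wave. -/
def waveSlope (A : Mat) (p : Fin 2 → ℝ) (e : Plane) (α : Plane) : ℂ :=
  coord A 0 e * cellSlope (p 0) (p 1) (Int.fract (coord A 1 α)) +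
    coord A 1 e * cellSlope (p 1) (p 0) (Int.fract (coord A 0 α))

/-- The phase factor of the nearest site. -/
def sitePhase (A : Mat) (K : Plane →L[ℝ] ℝ) (ω : Plane × Plane) : ℂ :=
  Complex.exp (K (ω.2 - act A !₂[Int.fract (coord A 0 ω.1), Int.fract (coord A 1 ω.1)]) *
    Complex.I)

/-- The squared norm of the gradient of an interpolated plane wave. -/
def waveGradSq (A : Mat) (K : Plane →L[ℝ] ℝ) (p : Fin 2 → ℝ) (a : Plane) (c : ℂ)
    (ω : Plane × Plane) : ℝ :=
  ‖a‖ ^ 2 * ∑ i, (c * (sitePhase A K ω *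
    waveSlope A p (EuclideanSpace.single i 1) ω.1)).re ^ 2

/-- The four corner values differ by phase factors `exp (i p_0)`, `exp (i p_1)`. Thus the slopes
depend on `K` only modulo 2π on the columns of `A`, up to a common unimodular factor: `p` may be
small although `K` is large. -/
theorem frobSq_interpolantGrad_wave {A : Mat} (hA : A.det ≠ 0) {K : Plane →L[ℝ] ℝ}
    {p : Fin 2 → ℝ} (hp : ∀ i, Complex.exp (K (act A (EuclideanSpace.single i 1)) * Complex.I) =
      Complex.exp (p i * Complex.I)) (a : Plane) (c : ℂ) {ω : Plane × Plane}
    (h : ∀ i, Int.fract (coord A i ω.1) ≠ 0) :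
    frobSq (interpolantGrad A (wave K a c) ω.1 ω.2) = waveGradSq A K p a c ω := by
  set s := Int.fract (coord A 0 ω.1) with hs
  set t := Int.fract (coord A 1 ω.1) with ht
  have hsite : ∀ x y : ℝ, act A !₂[s - x, t - y] = act A !₂[s, t] -
      (x • act A (EuclideanSpace.single 0 1) + y • act A (EuclideanSpace.single 1 1)) := by
    intro x y
    rw [← map_smul, ← map_smul, ← map_add, ← map_sub]
    congr 1
    ext i
    fin_cases i <;> simp
  have hw : ∀ x y : ℝ, Complex.exp (K (ω.2 - act A !₂[s - x, t - y]) * Complex.I) =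
      sitePhase A K ω * Complex.exp (x * (K (act A (EuclideanSpace.single 0 1)) * Complex.I)) *
        Complex.exp (y * (K (act A (EuclideanSpace.single 1 1)) * Complex.I)) := by
    intro x y
    rw [hsite, sitePhase, ← Complex.exp_add, ← Complex.exp_add]
    congr 1
    simp only [map_sub, map_add, map_smul, smul_eq_mul]
    push_cast
    ring
  have h00 := hw 0 0
  have h10 := hw 1 0
  have h01 := hw 0 1
  have h11 := hw 1 1
  simp only [sub_zero, Complex.ofReal_zero, Complex.ofReal_one, zero_mul, one_mul,
    Complex.exp_zero, mul_one, hp] at h00 h10 h01 h11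
  rw [interpolantGrad_eq hA _ ω.2 h s t hs ht, frobSq, waveGradSq, Finset.mul_sum]
  refine Finset.sum_congr rfl fun i _ => ?_
  set e : Plane := EuclideanSpace.single i 1
  have key : (-((coord A 0).smulRight
          ((1 - t) • (wave K a c (ω.2 - act A !₂[s - 1, t]) - wave K a c (ω.2 - act A !₂[s, t])) +
            t • (wave K a c (ω.2 - act A !₂[s - 1, t - 1]) -
              wave K a c (ω.2 - act A !₂[s, t - 1]))) +
        (coord A 1).smulRight
          ((1 - s) • (wave K a c (ω.2 - act A !₂[s, t - 1]) - wave K a c (ω.2 - act A !₂[s, t])) +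
            s • (wave K a c (ω.2 - act A !₂[s - 1, t - 1]) -
              wave K a c (ω.2 - act A !₂[s - 1, t]))))) e =
      -((c * (sitePhase A K ω * waveSlope A p e ω.1)).re • a) := by
    have hre : ∀ (r : ℝ) (z : ℂ), r * z.re = ((r : ℂ) * z).re := fun r z => by simp
    simp only [neg_apply, add_apply, ContinuousLinearMap.smulRight_apply, wave, ← sub_smul,
      ← add_smul, smul_smul, neg_inj]
    congr 1
    rw [h00, h10, h01, h11]
    simp only [← Complex.sub_re, hre, ← Complex.add_re]
    congr 1
    rw [waveSlope, cellSlope, cellSlope, ← hs, ← ht]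
    push_cast
    ring
  rw [key, norm_neg, norm_smul, mul_pow, Real.norm_eq_abs, sq_abs, mul_comm]

end Moire
end

noncomputable section

namespace Moire

/-! ### The atomistic energy of plane waves -/

theorem integral_linear_combination {α : Type*} [MeasurableSpace α] {μ : Measure α}
    {f g h : α → ℝ} (hf : Integrable f μ) (hg : Integrable g μ) (hh : Integrable h μ)
    (x y z : ℝ) : ∫ t, (x * f t + y * g t + z * h t) ∂μ =
      x * ∫ t, f t ∂μ + y * ∫ t, g t ∂μ + z * ∫ t, h t ∂μ := by
  have hfg : Integrable (fun t => x * f t + y * g t) μ :=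
    (hf.const_mul x).add (hg.const_mul y)
  rw [integral_add hfg (hh.const_mul z), integral_add (hf.const_mul x) (hg.const_mul y),
    integral_const_mul, integral_const_mul, integral_const_mul]

/-- A bound linear in `|x|` is what makes the normalized cosine stencil bounded. For `|x| ≤ 2` it
comes from `1 - cos x ≤ x² / 2`, otherwise from `1 - cos x ≤ 2`. -/
theorem abs_cos_sub_one_le (x : ℝ) : |Real.cos x - 1| ≤ |x| := by
  have h1 := Real.one_sub_sq_div_two_le_cos (x := x)
  have h2 := Real.cos_le_one x
  have h3 := Real.neg_one_le_cos x
  rw [abs_sub_comm, abs_of_nonneg (by linarith)]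
  rcases le_total |x| 2 with h | h
  · nlinarith [abs_nonneg x, sq_abs x]
  · linarith

/-- The stencil with values `f ρ • a`. -/
def scalarStencil {A : Mat} (a : Plane) (f : Bond A → ℝ) (κ : ℝ)
    (hf : ∀ ρ, |f ρ| ≤ κ * ‖ρ.1‖) : Stencil A :=
  ⟨fun ρ => (‖ρ.1‖⁻¹ * f ρ) • a, memℓp_infty ⟨κ * ‖a‖, by
    rintro _ ⟨ρ, rfl⟩
    simp only [norm_smul, norm_mul, norm_inv, Real.norm_eq_abs, abs_norm]
    gcongr
    rw [inv_mul_le_iff₀ (norm_pos_iff.mpr ρ.2.2), mul_comm]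
    exact hf ρ⟩⟩

theorem norm_scalarStencil_apply_le {A : Mat} (a : Plane) (f : Bond A → ℝ) (κ : ℝ)
    (hf : ∀ ρ, |f ρ| ≤ κ * ‖ρ.1‖) (ρ : Bond A) : ‖scalarStencil a f κ hf ρ‖ ≤ κ * ‖a‖ := by
  change ‖(‖ρ.1‖⁻¹ * f ρ) • a‖ ≤ _
  simp only [norm_smul, norm_mul, norm_inv, Real.norm_eq_abs, abs_norm]
  gcongr
  rw [inv_mul_le_iff₀ (norm_pos_iff.mpr ρ.2.2), mul_comm]
  exact hf ρ

theorem abs_apply_le (K : Plane →L[ℝ] ℝ) (x : Plane) : |K x| ≤ ‖K‖ * ‖x‖ := K.le_opNorm x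

/-- The real part of the difference stencil of a complex plane wave. -/
def cosStencil (A : Mat) (K : Plane →L[ℝ] ℝ) (a : Plane) : Stencil A :=
  scalarStencil a (fun ρ => Real.cos (K ρ.1) - 1) ‖K‖ fun _ =>
    (abs_cos_sub_one_le _).trans (abs_apply_le K _)

/-- The imaginary part of the difference stencil of a complex plane wave. -/
def sinStencil (A : Mat) (K : Plane →L[ℝ] ℝ) (a : Plane) : Stencil A :=
  scalarStencil a (fun ρ => Real.sin (K ρ.1)) ‖K‖ fun _ =>
    Real.abs_sin_le_abs.trans (abs_apply_le K _)

theorem cosStencil_apply (A : Mat) (K : Plane →L[ℝ] ℝ) (a : Plane) (ρ : Bond A) :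
    cosStencil A K a ρ = (‖ρ.1‖⁻¹ * (Real.cos (K ρ.1) - 1)) • a := rfl

theorem sinStencil_apply (A : Mat) (K : Plane →L[ℝ] ℝ) (a : Plane) (ρ : Bond A) :
    sinStencil A K a ρ = (‖ρ.1‖⁻¹ * Real.sin (K ρ.1)) • a := rfl

/-- The difference stencil of a plane wave, in terms of the complex value at the center. -/
def waveStencil (A : Mat) (K : Plane →L[ℝ] ℝ) (a : Plane) (w : ℂ) : Stencil A :=
  w.re • cosStencil A K a + w.im • sinStencil A K a

/-- With `w` the complex value at `γ`, the difference over the bond `ρ` is the real part of `w (exp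
(-i K ρ) - 1)`, that is `w.re (cos (K ρ) - 1) + w.im sin (K ρ)`. -/
theorem diffStencil_wave (A : Mat) (K : Plane →L[ℝ] ℝ) (a : Plane) (c : ℂ) (t : ℝ)
    (γ : Plane) : diffStencil A (fun γ => t • wave K a c γ) γ =
      stencilFamily (t • waveStencil A K a (c * Complex.exp (K γ * Complex.I))) := by
  funext ρ
  have hρ : ‖ρ.1‖ ≠ 0 := norm_ne_zero_iff.mpr ρ.2.2
  have h1 : (t • waveStencil A K a (c * Complex.exp (K γ * Complex.I))) ρ =
      t • ((c * Complex.exp (K γ * Complex.I)).re • cosStencil A K a ρ +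
        (c * Complex.exp (K γ * Complex.I)).im • sinStencil A K a ρ) := rfl
  have h2 : c * Complex.exp (K (γ - ρ.1) * Complex.I) =
      c * Complex.exp (K γ * Complex.I) * (Real.cos (K ρ.1) - Real.sin (K ρ.1) * Complex.I) := by
    have h3 : Complex.exp (((-K ρ.1 : ℝ) : ℂ) * Complex.I) =
        Real.cos (K ρ.1) - Real.sin (K ρ.1) * Complex.I := by
      rw [Complex.exp_mul_I, ← Complex.ofReal_cos, ← Complex.ofReal_sin, Real.cos_neg,
        Real.sin_neg]
      push_cast
      ring
    rw [← h3, mul_assoc, ← Complex.exp_add]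
    congr 2
    push_cast [map_sub]
    ring
  rw [stencilFamily, diffStencil, h1, cosStencil_apply, sinStencil_apply, wave, wave, h2]
  set w := c * Complex.exp (K γ * Complex.I)
  simp only [smul_smul, ← add_smul, ← sub_smul]
  congr 1
  simp only [Complex.mul_re, Complex.sub_re, Complex.sub_im, Complex.ofReal_re,
    Complex.ofReal_im, Complex.mul_im, Complex.I_re, Complex.I_im]
  field_simp
  ring

theorem continuous_wave (K : Plane →L[ℝ] ℝ) (a : Plane) (c : ℂ) : Continuous (wave K a c) := by
  unfold wave
  fun_prop

theorem periodic_wave {B : Mat} {K : Plane →L[ℝ] ℝ}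
    (hK : ∀ l ∈ lattice B, ∃ z : ℤ, K l = z * (2 * Real.pi)) (a : Plane) (c : ℂ) :
    Periodic B (wave K a c) := by
  intro l hl x
  obtain ⟨z, hz⟩ := hK l hl
  have h1 : Complex.exp (K (x + l) * Complex.I) = Complex.exp (K x * Complex.I) := by
    rw [map_add, hz, Complex.exp_eq_exp_iff_exists_int]
    exact ⟨z, by push_cast; ring⟩
  rw [wave, wave, h1]

/-- The second variation of the atomistic energy along a plane wave. -/
theorem IsSitePotential.atomSecondVar_wave {A B : Mat} (hB : B.det ≠ 0) {κ₀ : ℝ} (hκ : 0 < κ₀)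
    {V : (Bond A → Plane) → ℝ} (hV : IsSitePotential A κ₀ V) (K : Plane →L[ℝ] ℝ) (a : Plane)
    (c : ℂ) : atomSecondVar A B V (wave K a c) =
      ∫ y in unitCell, hessian V (waveStencil A K a (c * Complex.exp (K (act B y) * Complex.I)))
        (waveStencil A K a (c * Complex.exp (K (act B y) * Complex.I))) := by
  have h1 : ∀ t : ℝ, atomEnergy A B V (fun γ => t • wave K a c γ) = ∫ y in unitCell,
      potential V (t • waveStencil A K a (c * Complex.exp (K (act B y) * Complex.I))) := by
    intro t
    rw [atomEnergy, average_cell hB]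
    simp only [diffStencil_wave, potential]
  rw [atomSecondVar, funext h1, iteratedDeriv_two_integral (hV.contDiffAt (by simpa using hκ))
    (C := ‖c‖ * ‖cosStencil A K a‖ + ‖c‖ * ‖sinStencil A K a‖)]
  · simp only [hessian_eq]
  -- The stencils lie in the span of two fixed ones, so continuity in the stencil norm reduces to
  -- that of one complex number.
  · unfold waveStencil
    have : Continuous fun y => c * Complex.exp (K (act B y) * Complex.I) := by fun_prop
    exact ((Complex.continuous_re.comp this).smul continuous_const).add
      ((Complex.continuous_im.comp this).smul continuous_const)
  · intro y
    have hw : ‖c * Complex.exp (K (act B y) * Complex.I)‖ = ‖c‖ := by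
      rw [norm_mul, Complex.norm_exp_ofReal_mul_I, mul_one]
    refine (norm_add_le _ _).trans (add_le_add ?_ ?_) <;> rw [norm_smul, Real.norm_eq_abs] <;>
      gcongr <;> rw [← hw]
    · exact Complex.abs_re_le_norm _
    · exact Complex.abs_im_le_norm _

theorem waveStencil_real_smul_add (A : Mat) (K : Plane →L[ℝ] ℝ) (a : Plane) (x y : ℝ) (w : ℂ) :
    waveStencil A K a ((x + y * Complex.I) * w) =
      x • waveStencil A K a w + y • waveStencil A K a (Complex.I * w) := by
  simp only [waveStencil, Complex.mul_re, Complex.mul_im, Complex.add_re, Complex.add_im,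
    Complex.ofReal_re, Complex.ofReal_im, Complex.I_re, Complex.I_im]
  module

/-- The second variation along the plane waves of a given wave vector is a binary quadratic
form. -/
theorem IsSitePotential.exists_binary_form {A B : Mat} (hB : B.det ≠ 0) {κ₀ : ℝ} (hκ : 0 < κ₀)
    {V : (Bond A → Plane) → ℝ} (hV : IsSitePotential A κ₀ V) (K : Plane →L[ℝ] ℝ) (a : Plane) :
    ∃ s t u : ℝ, s + u = hessian V (cosStencil A K a) (cosStencil A K a) +
        hessian V (sinStencil A K a) (sinStencil A K a) ∧
      ∀ x y : ℝ, atomSecondVar A B V (wave K a (x + y * Complex.I)) =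
        s * x ^ 2 + 2 * t * (x * y) + u * y ^ 2 := by
  let X : Plane → Stencil A := fun y => waveStencil A K a (Complex.exp (K (act B y) * Complex.I))
  let Y : Plane → Stencil A := fun y =>
    waveStencil A K a (Complex.I * Complex.exp (K (act B y) * Complex.I))
  let p := hessian V (cosStencil A K a) (cosStencil A K a)
  let q := hessian V (sinStencil A K a) (sinStencil A K a)
  -- Only the symmetrized mixed term occurs, so the symmetry of the second differential plays no
  -- role.
  let m := hessian V (cosStencil A K a) (sinStencil A K a) +
    hessian V (sinStencil A K a) (cosStencil A K a)
  have hC : ∀ y, Complex.exp (K (act B y) * Complex.I) =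
      Real.cos (K (act B y)) + Real.sin (K (act B y)) * Complex.I := fun y => by
    rw [Complex.exp_mul_I, Complex.ofReal_cos, Complex.ofReal_sin]
  have hX : ∀ y, hessian V (X y) (X y) = Real.cos (K (act B y)) ^ 2 * p +
      Real.cos (K (act B y)) * Real.sin (K (act B y)) * m + Real.sin (K (act B y)) ^ 2 * q := by
    intro y
    simp only [X, waveStencil, hC, p, q, m, hessian_eq, map_add, map_smul, add_apply, smul_apply,
      smul_eq_mul, Complex.add_re, Complex.add_im, Complex.mul_re, Complex.mul_im,
      Complex.ofReal_re, Complex.ofReal_im, Complex.I_re, Complex.I_im]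
    ring
  have hY : ∀ y, hessian V (Y y) (Y y) = Real.sin (K (act B y)) ^ 2 * p -
      Real.cos (K (act B y)) * Real.sin (K (act B y)) * m + Real.cos (K (act B y)) ^ 2 * q := by
    intro y
    simp only [Y, waveStencil, hC, p, q, m, hessian_eq, map_add, map_smul, add_apply, smul_apply,
      smul_eq_mul, Complex.add_re, Complex.add_im, Complex.mul_re, Complex.mul_im,
      Complex.ofReal_re, Complex.ofReal_im, Complex.I_re, Complex.I_im]
    ring
  have hXY : ∀ y, hessian V (X y) (Y y) + hessian V (Y y) (X y) =
      (Real.cos (K (act B y)) ^ 2 - Real.sin (K (act B y)) ^ 2) * m +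
        2 * (Real.cos (K (act B y)) * Real.sin (K (act B y))) * (q - p) := by
    intro y
    simp only [X, Y, waveStencil, hC, p, q, m, hessian_eq, map_add, map_smul, add_apply,
      smul_apply, smul_eq_mul, Complex.add_re, Complex.add_im, Complex.mul_re, Complex.mul_im,
      Complex.ofReal_re, Complex.ofReal_im, Complex.I_re, Complex.I_im]
    ring
  have hint : ∀ {f : ℝ → ℝ}, Continuous f → (∃ C, ∀ x, |f x| ≤ C) →
      Integrable (fun y => f (K (act B y))) (volume.restrict unitCell) := fun hf ⟨C, hC⟩ =>
    Integrable.of_bound (by fun_prop) C (Filter.Eventually.of_forall fun y => hC _)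
  have i1 : Integrable (fun y => Real.cos (K (act B y)) ^ 2) (volume.restrict unitCell) :=
    hint (f := fun x => Real.cos x ^ 2) (by fun_prop) ⟨1, fun x => by
      rw [abs_of_nonneg (sq_nonneg _)]; exact Real.cos_sq_le_one x⟩
  have i2 : Integrable (fun y => Real.sin (K (act B y)) ^ 2) (volume.restrict unitCell) :=
    hint (f := fun x => Real.sin x ^ 2) (by fun_prop) ⟨1, fun x => by
      rw [abs_of_nonneg (sq_nonneg _)]; exact Real.sin_sq_le_one x⟩
  have i3 : Integrable (fun y => Real.cos (K (act B y)) * Real.sin (K (act B y)))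
      (volume.restrict unitCell) :=
    hint (f := fun x => Real.cos x * Real.sin x) (by fun_prop) ⟨1, fun x => by
      rw [abs_mul]
      exact mul_le_one₀ (Real.abs_cos_le_one x) (abs_nonneg _) (Real.abs_sin_le_one x)⟩
  have iX : Integrable (fun y => hessian V (X y) (X y)) (volume.restrict unitCell) := by
    simp only [hX]
    exact ((i1.mul_const _).add (i3.mul_const _)).add (i2.mul_const _)
  have iY : Integrable (fun y => hessian V (Y y) (Y y)) (volume.restrict unitCell) := by
    simp only [hY]
    exact ((i2.mul_const _).sub (i3.mul_const _)).add (i1.mul_const _)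
  have iXY : Integrable (fun y => hessian V (X y) (Y y) + hessian V (Y y) (X y))
      (volume.restrict unitCell) := by
    simp only [hXY]
    exact ((i1.sub i2).mul_const _).add ((i3.const_mul 2).mul_const _)
  refine ⟨∫ y in unitCell, hessian V (X y) (X y),
    (∫ y in unitCell, (hessian V (X y) (Y y) + hessian V (Y y) (X y))) / 2,
    ∫ y in unitCell, hessian V (Y y) (Y y), ?_, fun x y => ?_⟩
  · rw [← integral_add iX iY]
    -- The waves with `c = 1` and `c = i` are a quarter period apart: in the sum of their energies
    -- `cos² + sin² = 1` removes the dependence on the configuration.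
    have : ∀ y, hessian V (X y) (X y) + hessian V (Y y) (Y y) = p + q := fun y => by
      rw [hX, hY]
      linear_combination (p + q) * Real.sin_sq_add_cos_sq (K (act B y))
    simp only [this, integral_const, probReal_univ, one_smul, p, q]
  · rw [hV.atomSecondVar_wave hB hκ]
    have : ∀ z, hessian V
        (waveStencil A K a ((x + y * Complex.I) * Complex.exp (K (act B z) * Complex.I)))
        (waveStencil A K a ((x + y * Complex.I) * Complex.exp (K (act B z) * Complex.I))) =
        x ^ 2 * hessian V (X z) (X z) +
          (x * y) * (hessian V (X z) (Y z) + hessian V (Y z) (X z)) +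
            y ^ 2 * hessian V (Y z) (Y z) := by
      intro z
      rw [waveStencil_real_smul_add]
      simp only [X, Y, hessian_eq, map_add, map_smul, add_apply, smul_apply, smul_eq_mul]
      ring
    simp only [this]
    rw [integral_linear_combination iX iXY iY]
    ring

end Moire
end

noncomputable section

namespace Moire

/-! ### Stability of plane waves -/

/-- The second factor is a convex combination of two unimodular numbers, and a chord of the unit
circle is shorter than its arc. -/
theorem norm_cellSlope_le (p q : ℝ) {t : ℝ} (h0 : 0 ≤ t) (h1 : t ≤ 1) :
    ‖cellSlope p q t‖ ≤ |p| := by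
  have e1 : ‖Complex.exp (p * Complex.I) - 1‖ ≤ |p| := by
    rw [mul_comm]
    exact Real.norm_exp_I_mul_ofReal_sub_one_le
  have e2 : ‖((1 : ℂ) - t) + t * Complex.exp (q * Complex.I)‖ ≤ 1 := by
    refine (norm_add_le _ _).trans ?_
    rw [norm_mul, Complex.norm_exp_ofReal_mul_I, ← Complex.ofReal_one, ← Complex.ofReal_sub,
      Complex.norm_real, Complex.norm_real, Real.norm_of_nonneg h0,
      Real.norm_of_nonneg (sub_nonneg.mpr h1)]
    linarith
  rw [cellSlope, norm_mul]
  exact (mul_le_of_le_one_right (norm_nonneg _) e2).trans e1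

theorem norm_waveSlope_le (A : Mat) (p : Fin 2 → ℝ) (e α : Plane) :
    ‖waveSlope A p e α‖ ≤ |coord A 0 e| * |p 0| + |coord A 1 e| * |p 1| := by
  refine (norm_add_le _ _).trans ?_
  rw [norm_mul, norm_mul, Complex.norm_real, Complex.norm_real, Real.norm_eq_abs,
    Real.norm_eq_abs]
  gcongr <;> exact norm_cellSlope_le _ _ (Int.fract_nonneg _) (Int.fract_lt_one _).le

theorem norm_sitePhase (A : Mat) (K : Plane →L[ℝ] ℝ) (ω : Plane × Plane) :
    ‖sitePhase A K ω‖ = 1 := Complex.norm_exp_ofReal_mul_I _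

theorem measurable_waveSlope (A : Mat) (p : Fin 2 → ℝ) (e : Plane) :
    Measurable (waveSlope A p e) := by
  have h : ∀ p q, Continuous (cellSlope p q) := fun p q => by
    unfold cellSlope
    fun_prop
  have hf : ∀ i, Measurable fun α => Int.fract (coord A i α) := fun i =>
    measurable_fract.comp (coord A i).continuous.measurable
  exact (((h _ _).measurable.comp (hf 1)).const_mul _).add
    (((h _ _).measurable.comp (hf 0)).const_mul _)

theorem measurable_sitePhase (A : Mat) (K : Plane →L[ℝ] ℝ) : Measurable (sitePhase A K) := by
  have hf : ∀ i, Measurable fun ω : Plane × Plane => Int.fract (coord A i ω.1) := fun i =>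
    measurable_fract.comp ((coord A i).continuous.measurable.comp measurable_fst)
  have hc : Continuous fun q : Plane × ℝ × ℝ =>
      Complex.exp (K (q.1 - act A !₂[q.2.1, q.2.2]) * Complex.I) := by
    fun_prop
  exact hc.measurable.comp (measurable_snd.prodMk ((hf 0).prodMk (hf 1)))

theorem volume_cell_prod {A B : Mat} : volume (cell A ×ˢ cell B) =
    ENNReal.ofReal |A.det| * ENNReal.ofReal |B.det| := by
  rw [Measure.volume_eq_prod, Measure.prod_prod, volume_cell, volume_cell]

/-- The uniform probability measure on the pairs of configurations of the two layers. -/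
def cellMeasure (A B : Mat) : Measure (Plane × Plane) :=
  (volume.restrict (cell A ×ˢ cell B) univ)⁻¹ • volume.restrict (cell A ×ˢ cell B)

theorem isProbabilityMeasure_cellMeasure {A B : Mat} (hA : A.det ≠ 0) (hB : B.det ≠ 0) :
    IsProbabilityMeasure (cellMeasure A B) := by
  constructor
  rw [cellMeasure, Measure.smul_apply, smul_eq_mul, Measure.restrict_apply_univ, volume_cell_prod]
  refine ENNReal.inv_mul_cancel (mul_ne_zero ?_ ?_) (ENNReal.mul_ne_top ENNReal.ofReal_ne_top
    ENNReal.ofReal_ne_top) <;> simpa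

/-- The averaged squared gradient of the plane waves with wave vector `p` is a binary quadratic
form. -/
theorem exists_binary_form_grad {A B : Mat} (hA : A.det ≠ 0) (hB : B.det ≠ 0)
    {K : Plane →L[ℝ] ℝ} {p : Fin 2 → ℝ}
    (hp : ∀ i, Complex.exp (K (act A (EuclideanSpace.single i 1)) * Complex.I) =
      Complex.exp (p i * Complex.I)) (a : Plane) :
    ∃ s t u : ℝ, s + u = ∫ ω, ‖a‖ ^ 2 * ∑ i, Complex.normSq
        (waveSlope A p (EuclideanSpace.single i 1) ω.1) ∂(cellMeasure A B) ∧
      (∀ x y : ℝ, atomGradSq A B (wave K a (x + y * Complex.I)) =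
        s * x ^ 2 + 2 * t * (x * y) + u * y ^ 2) ∧
      ∀ x y : ℝ, 0 ≤ s * x ^ 2 + 2 * t * (x * y) + u * y ^ 2 := by
  have := isProbabilityMeasure_cellMeasure hA hB
  let g : Fin 2 → Plane × Plane → ℂ := fun i ω =>
    sitePhase A K ω * waveSlope A p (EuclideanSpace.single i 1) ω.1
  have hgm : ∀ i, Measurable (g i) := fun i =>
    (measurable_sitePhase A K).mul ((measurable_waveSlope A p _).comp measurable_fst)
  obtain ⟨M, hM⟩ : ∃ M : ℝ, ∀ i ω, ‖g i ω‖ ≤ M := by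
    refine ⟨∑ i : Fin 2, (|coord A 0 (EuclideanSpace.single i 1)| * |p 0| +
      |coord A 1 (EuclideanSpace.single i 1)| * |p 1|), fun i ω => ?_⟩
    rw [norm_mul, norm_sitePhase, one_mul]
    refine (norm_waveSlope_le A p _ _).trans ?_
    exact Finset.single_le_sum (f := fun i : Fin 2 =>
      (|coord A 0 (EuclideanSpace.single i 1)| * |p 0| +
      |coord A 1 (EuclideanSpace.single i 1)| * |p 1|)) (fun _ _ => by positivity)
      (Finset.mem_univ i)
  have hM0 : 0 ≤ M := (norm_nonneg _).trans (hM 0 0)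
  have hre : ∀ i ω, |(g i ω).re| ≤ M := fun i ω => (Complex.abs_re_le_norm _).trans (hM i ω)
  have him : ∀ i ω, |(g i ω).im| ≤ M := fun i ω => (Complex.abs_im_le_norm _).trans (hM i ω)
  have hmr : ∀ i, Measurable fun ω => (g i ω).re := fun i => Complex.measurable_re.comp (hgm i)
  have hmi : ∀ i, Measurable fun ω => (g i ω).im := fun i => Complex.measurable_im.comp (hgm i)
  have hprod : ∀ {f h : Plane × Plane → ℝ}, Measurable f → Measurable h →
      (∀ ω, |f ω| ≤ M) → (∀ ω, |h ω| ≤ M) →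
      Integrable (fun ω => f ω * h ω) (cellMeasure A B) := fun hf hh bf bh =>
    Integrable.of_bound (hf.mul hh).aestronglyMeasurable (M * M)
      (Filter.Eventually.of_forall fun ω => by
        rw [norm_mul]
        exact mul_le_mul (bf ω) (bh ω) (norm_nonneg _) hM0)
  have i1 : Integrable (fun ω => ‖a‖ ^ 2 * ∑ i, (g i ω).re * (g i ω).re) (cellMeasure A B) :=
    (integrable_finsetSum _ fun i _ => hprod (hmr i) (hmr i) (hre i) (hre i)).const_mul _
  have i2 : Integrable (fun ω => ‖a‖ ^ 2 * ∑ i, (g i ω).re * (g i ω).im) (cellMeasure A B) :=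
    (integrable_finsetSum _ fun i _ => hprod (hmr i) (hmi i) (hre i) (him i)).const_mul _
  have i3 : Integrable (fun ω => ‖a‖ ^ 2 * ∑ i, (g i ω).im * (g i ω).im) (cellMeasure A B) :=
    (integrable_finsetSum _ fun i _ => hprod (hmi i) (hmi i) (him i) (him i)).const_mul _
  have hform : ∀ x y : ℝ, ∫ ω, waveGradSq A K p a (x + y * Complex.I) ω ∂(cellMeasure A B) =
      (∫ ω, ‖a‖ ^ 2 * ∑ i, (g i ω).re * (g i ω).re ∂(cellMeasure A B)) * x ^ 2 +
      2 * (-∫ ω, ‖a‖ ^ 2 * ∑ i, (g i ω).re * (g i ω).im ∂(cellMeasure A B)) * (x * y) +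
      (∫ ω, ‖a‖ ^ 2 * ∑ i, (g i ω).im * (g i ω).im ∂(cellMeasure A B)) * y ^ 2 := by
    intro x y
    have h1 : ∀ ω, waveGradSq A K p a (x + y * Complex.I) ω =
        x ^ 2 * (‖a‖ ^ 2 * ∑ i, (g i ω).re * (g i ω).re) +
        (-2 * (x * y)) * (‖a‖ ^ 2 * ∑ i, (g i ω).re * (g i ω).im) +
        y ^ 2 * (‖a‖ ^ 2 * ∑ i, (g i ω).im * (g i ω).im) := by
      intro ω
      change ‖a‖ ^ 2 * ∑ i, ((x + y * Complex.I) * g i ω).re ^ 2 = _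
      simp only [Fin.sum_univ_two, Complex.mul_re, Complex.add_re, Complex.add_im,
        Complex.ofReal_re, Complex.ofReal_im, Complex.mul_im, Complex.I_re, Complex.I_im]
      ring
    simp only [h1]
    rw [integral_linear_combination i1 i2 i3]
    ring
  refine ⟨∫ ω, ‖a‖ ^ 2 * ∑ i, (g i ω).re * (g i ω).re ∂(cellMeasure A B),
    -∫ ω, ‖a‖ ^ 2 * ∑ i, (g i ω).re * (g i ω).im ∂(cellMeasure A B),
    ∫ ω, ‖a‖ ^ 2 * ∑ i, (g i ω).im * (g i ω).im ∂(cellMeasure A B), ?_, fun x y => ?_,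
    fun x y => ?_⟩
  · rw [← integral_add i1 i3]
    refine integral_congr_ae (Filter.Eventually.of_forall fun ω => ?_)
    simp only
    rw [← mul_add, ← Finset.sum_add_distrib]
    congr 1
    refine Finset.sum_congr rfl fun i _ => ?_
    -- In the trace the unimodular site phase disappears, and with it the dependence on `K` beyond
    -- `p`.
    rw [← Complex.normSq_apply, Complex.normSq_mul, Complex.normSq_eq_norm_sq (sitePhase A K ω),
      norm_sitePhase, one_pow, one_mul]
  · rw [← hform]
    refine average_congr ?_
    -- The formula for the interpolated gradient is only needed off the null set of cell boundaries.
    have h1 : ∀ᵐ α : Plane, ∀ i, Int.fract (coord A i α) ≠ 0 :=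
      ae_all_iff.mpr fun i => ae_fract_coord_ne_zero hA i
    have h2 : ∀ᵐ ω : Plane × Plane, ∀ i, Int.fract (coord A i ω.1) ≠ 0 :=
      Measure.quasiMeasurePreserving_fst.ae h1
    filter_upwards [ae_restrict_of_ae h2] with ω hω
    exact frobSq_interpolantGrad_wave hA hp a _ hω
  · rw [← hform]
    exact integral_nonneg fun ω => mul_nonneg (sq_nonneg _)
      (Finset.sum_nonneg fun i _ => sq_nonneg _)

/-- By homogeneity the first form is at least `C` times the second wherever the second is positive.
If both diagonal entries `s'`, `u'` are positive, the inequalities at the two unit vectors add up.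
If one of them vanishes, nonnegativity forces `t' = 0`; the first form is then bounded below on a
whole line, so its entry in that direction is nonnegative. -/
theorem add_le_add_of_binary_forms {C s t u s' t' u' : ℝ}
    (hG : ∀ x y : ℝ, 0 ≤ s' * x ^ 2 + 2 * t' * (x * y) + u' * y ^ 2)
    (hS : ∀ x y : ℝ, s' * x ^ 2 + 2 * t' * (x * y) + u' * y ^ 2 = 1 →
      C ≤ s * x ^ 2 + 2 * t * (x * y) + u * y ^ 2) (hpos : 0 < s' + u') :
    C * (s' + u') ≤ s + u := by
  have hscale : ∀ x y : ℝ, 0 < s' * x ^ 2 + 2 * t' * (x * y) + u' * y ^ 2 →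
      C * (s' * x ^ 2 + 2 * t' * (x * y) + u' * y ^ 2) ≤
        s * x ^ 2 + 2 * t * (x * y) + u * y ^ 2 := by
    intro x y h
    set g := s' * x ^ 2 + 2 * t' * (x * y) + u' * y ^ 2 with hg
    have hr : (Real.sqrt g)⁻¹ ^ 2 = g⁻¹ := by rw [inv_pow, Real.sq_sqrt h.le]
    have h1 := hS ((Real.sqrt g)⁻¹ * x) ((Real.sqrt g)⁻¹ * y) (by
      have : s' * ((Real.sqrt g)⁻¹ * x) ^ 2 + 2 * t' * (((Real.sqrt g)⁻¹ * x) *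
          ((Real.sqrt g)⁻¹ * y)) + u' * ((Real.sqrt g)⁻¹ * y) ^ 2 =
          (Real.sqrt g)⁻¹ ^ 2 * g := by rw [hg]; ring
      rw [this, hr, inv_mul_cancel₀ h.ne'])
    have h2 : s * ((Real.sqrt g)⁻¹ * x) ^ 2 + 2 * t * (((Real.sqrt g)⁻¹ * x) *
        ((Real.sqrt g)⁻¹ * y)) + u * ((Real.sqrt g)⁻¹ * y) ^ 2 =
        (Real.sqrt g)⁻¹ ^ 2 * (s * x ^ 2 + 2 * t * (x * y) + u * y ^ 2) := by ring
    rw [h2, hr, inv_mul_eq_div, le_div_iff₀ h] at h1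
    exact h1
  -- A quadratic polynomial bounded below has a nonnegative leading coefficient: evaluation at two
  -- opposite points cancels the linear term, and the point is chosen so large that the quadratic
  -- term outweighs `d`.
  have hzero : ∀ {b c d : ℝ}, (∀ x : ℝ, 0 ≤ b * x ^ 2 + 2 * c * x + d) → 0 ≤ b := by
    intro b c d h
    by_contra! hb
    have h1 := h ((|c| + |d| + 1) / (-b) + 1)
    have h2 := h (-((|c| + |d| + 1) / (-b) + 1))
    have hb' : b * ((|c| + |d| + 1) / (-b)) = -(|c| + |d| + 1) := by
      rw [div_neg, mul_neg, mul_div_cancel₀ _ hb.ne]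
    set z := (|c| + |d| + 1) / (-b) with hz
    have hz0 : 0 < z := div_pos (by positivity) (by linarith)
    have h3 : b * (z + 1) ^ 2 = -(|c| + |d| + 1) * (z + 1) + b * (z + 1) := by
      linear_combination (z + 1) * hb'
    nlinarith [abs_nonneg c, abs_nonneg d, le_abs_self d, mul_pos (neg_pos.mpr hb) hz0]
  have hlin : ∀ {c d : ℝ}, (∀ x : ℝ, 0 ≤ 2 * c * x + d) → c = 0 := by
    intro c d h
    by_contra hc
    have h1 := h ((-d - 1) / (2 * c))
    rw [mul_div_cancel₀ _ (by simpa using hc)] at h1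
    linarith
  have hs' : 0 ≤ s' := by simpa using hG 1 0
  have hu' : 0 ≤ u' := by simpa using hG 0 1
  rcases hs'.eq_or_lt with h0 | hs
  · have ht' : t' = 0 := hlin (d := u') fun x => by
      have := hG x 1
      rw [← h0] at this
      linarith
    have hu : 0 < u' := by linarith
    have h1 : 0 ≤ s := hzero (c := t) (d := u - C * u') fun x => by
      have := hscale x 1 (by rw [← h0, ht']; linarith)
      rw [← h0, ht'] at this
      linarith
    have h2 := hscale 0 1 (by linarith)
    rw [← h0]
    linarith
  · rcases hu'.eq_or_lt with h0 | hu
    · have ht' : t' = 0 := hlin (d := s') fun x => by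
        have := hG 1 x
        rw [← h0] at this
        linarith
      have h1 : 0 ≤ u := hzero (c := t) (d := s - C * s') fun x => by
        have := hscale 1 x (by rw [← h0, ht']; linarith)
        rw [← h0, ht'] at this
        linarith
      have h2 := hscale 1 0 (by linarith)
      rw [← h0]
      linarith
    · have h1 := hscale 1 0 (by linarith)
      have h2 := hscale 0 1 (by linarith)
      linarith

/-- The stability inequality for plane waves. -/
theorem IsSitePotential.layerConst_mul_le_hessian {A B : Mat} (hA : A.det ≠ 0) (hB : B.det ≠ 0)
    {κ₀ : ℝ} (hκ : 0 < κ₀) {V : (Bond A → Plane) → ℝ} (hV : IsSitePotential A κ₀ V)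
    (hC : 0 < layerConst A B V) {K : Plane →L[ℝ] ℝ} {p : Fin 2 → ℝ}
    (hK : ∀ l ∈ lattice B, ∃ z : ℤ, K l = z * (2 * Real.pi))
    (hp : ∀ i, Complex.exp (K (act A (EuclideanSpace.single i 1)) * Complex.I) =
      Complex.exp (p i * Complex.I)) (a : Plane)
    (hpos : 0 < ∫ ω, ‖a‖ ^ 2 * ∑ i, Complex.normSq
        (waveSlope A p (EuclideanSpace.single i 1) ω.1) ∂(cellMeasure A B)) :
    layerConst A B V * ∫ ω, ‖a‖ ^ 2 * ∑ i, Complex.normSq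
        (waveSlope A p (EuclideanSpace.single i 1) ω.1) ∂(cellMeasure A B) ≤
      hessian V (cosStencil A K a) (cosStencil A K a) +
        hessian V (sinStencil A K a) (sinStencil A K a) := by
  obtain ⟨s, t, u, hsu, hS⟩ := hV.exists_binary_form hB hκ K a
  obtain ⟨s', t', u', hsu', hG, hG0⟩ := exists_binary_form_grad hA hB hp a
  rw [← hsu', ← hsu]
  refine add_le_add_of_binary_forms (t := t) hG0 (fun x y hxy => ?_) (hsu' ▸ hpos)
  rw [← hS]
  refine csInf_le ?_ ⟨wave K a (x + y * Complex.I), continuous_wave _ _ _, periodic_wave hK _ _,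
    by rw [hG, hxy], rfl⟩
  -- The real infimum of a set that is not bounded below is `0` by convention, which positivity of
  -- the constant excludes.
  by_contra hbdd
  rw [layerConst, Real.sInf_of_not_bddBelow hbdd] at hC
  exact lt_irrefl _ hC

end Moire
end

noncomputable section

namespace Moire

open Filter Topology

/-! ### The Legendre–Hadamard condition -/

theorem tendsto_zero_of_rescaled {x : ℕ → ℝ} {L : ℝ}
    (hx : Tendsto (fun n : ℕ => ((n : ℝ) + 1) * x n) atTop (𝓝 L)) : Tendsto x atTop (𝓝 0) := by
  have h := tendsto_one_div_add_atTop_nhds_zero_nat (𝕜 := ℝ) |>.mul hx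
  rw [zero_mul] at h
  refine h.congr fun n => ?_
  have : (n : ℝ) + 1 ≠ 0 := by positivity
  field_simp

/-- Rescaled values of a function differentiable at `0` along a sequence of order `1 / n`. -/
theorem tendsto_rescaled {E : Type*} [NormedAddCommGroup E] [NormedSpace ℝ E] {f : ℝ → E} {f' : E}
    (hf : HasDerivAt f f' 0) {x : ℕ → ℝ} {L : ℝ}
    (hx : Tendsto (fun n : ℕ => ((n : ℝ) + 1) * x n) atTop (𝓝 L)) :
    Tendsto (fun n : ℕ => ((n : ℝ) + 1) • (f (x n) - f 0)) atTop (𝓝 (L • f')) := by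
  have h := (hf.hasFDerivAt.hasFDerivWithinAt (s := univ)).lim (c := fun n : ℕ => (n : ℝ) + 1)
    (d := x) (v := L) (tendsto_zero_of_rescaled hx) (by simp) hx
  simpa using h

theorem eq_sum_apply_smul_coord {A : Mat} (hA : A.det ≠ 0) (l : Plane →L[ℝ] ℝ) :
    l = ∑ i, l (act A (EuclideanSpace.single i 1)) • coord A i := by
  ext1 x
  conv_lhs => rw [eq_sum_coord hA x]
  simp [mul_comm]

theorem act_inv_act_single (A B : Mat) (i j : Fin 2) :
    act B⁻¹ (act A (EuclideanSpace.single i 1)) j = (B⁻¹ * A) j i := by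
  have h : act B⁻¹ * act A = act (B⁻¹ * A) := by rw [act, act, ← map_mul]; rfl
  have h2 : act B⁻¹ (act A (EuclideanSpace.single i 1)) =
      act (B⁻¹ * A) (EuclideanSpace.single i 1) := DFunLike.congr_fun h _
  rw [h2, act_apply]
  simp

/-- Wave vectors in the dual lattice of `B` which, modulo the dual lattice of `A`, tend to `0`
in a given direction. -/
theorem exists_wave_vectors {A B : Mat} (hA : A.det ≠ 0) (hB : B.det ≠ 0)
    (hAB : lattice A ∩ lattice B = {0}) (l : Plane →L[ℝ] ℝ) :
    ∃ (K : ℕ → Plane →L[ℝ] ℝ) (p : ℕ → Fin 2 → ℝ),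
      (∀ n, ∀ x ∈ lattice B, ∃ z : ℤ, K n x = z * (2 * Real.pi)) ∧
      (∀ n i, ∃ z : ℤ, K n (act A (EuclideanSpace.single i 1)) = p n i + z * (2 * Real.pi)) ∧
      ∀ i, Tendsto (fun n : ℕ => ((n : ℝ) + 1) * p n i) atTop
        (𝓝 (l (act A (EuclideanSpace.single i 1)))) := by
  have hpi : (0 : ℝ) < 2 * Real.pi := by positivity
  have hpos : ∀ n : ℕ, (0 : ℝ) < n + 1 := fun n => by positivity
  -- The target is `l / (2π (n + 1))` on the columns of `A`. The error `1 / (n + 1)²` is of smaller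
  -- order, so it still vanishes after multiplication by `2π (n + 1)`.
  choose k m hkm using fun n : ℕ => exists_dual_approx hA hB hAB
    (fun i => l (act A (EuclideanSpace.single i 1)) / (2 * Real.pi * (n + 1)))
    (ε := 1 / ((n : ℝ) + 1) ^ 2) (by positivity)
  have hK : ∀ n i, (phaseCLM (k n)).comp (act B⁻¹) (act A (EuclideanSpace.single i 1)) =
      2 * Real.pi * ∑ j, (k n j : ℝ) * (B⁻¹ * A) j i := by
    intro n i
    rw [ContinuousLinearMap.comp_apply, phaseCLM_apply, phase]
    simp only [act_inv_act_single]
  refine ⟨fun n => (phaseCLM (k n)).comp (act B⁻¹),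
    fun n i => 2 * Real.pi * (∑ j, (k n j : ℝ) * (B⁻¹ * A) j i - m n i), ?_, ?_, ?_⟩
  · rintro n _ ⟨z, rfl⟩
    refine ⟨∑ i, k n i * z i, ?_⟩
    rw [ContinuousLinearMap.comp_apply, act_inv_act hB, phaseCLM_apply, phase]
    push_cast
    ring
  · intro n i
    exact ⟨m n i, by rw [hK]; ring⟩
  · intro i
    rw [tendsto_iff_norm_sub_tendsto_zero]
    have h0 : Tendsto (fun n : ℕ => 2 * Real.pi * (1 / ((n : ℝ) + 1))) atTop (𝓝 0) := by
      simpa using tendsto_one_div_add_atTop_nhds_zero_nat (𝕜 := ℝ) |>.const_mul (2 * Real.pi)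
    refine squeeze_zero (fun n => norm_nonneg _) (fun n => ?_) h0
    have h1 := (hkm n i).le
    have h2 : ((n : ℝ) + 1) * (2 * Real.pi * (∑ j, (k n j : ℝ) * (B⁻¹ * A) j i - m n i)) -
        l (act A (EuclideanSpace.single i 1)) = (2 * Real.pi * (n + 1)) *
        (∑ j, (k n j : ℝ) * (B⁻¹ * A) j i - m n i -
          l (act A (EuclideanSpace.single i 1)) / (2 * Real.pi * (n + 1))) := by
      have := (hpos n).ne'
      field_simp
    rw [h2, norm_mul, Real.norm_of_nonneg (by positivity), Real.norm_eq_abs]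
    calc _ ≤ (2 * Real.pi * (n + 1)) * (1 / ((n : ℝ) + 1) ^ 2) := by gcongr
      _ = _ := by have := (hpos n).ne'; field_simp

/-- The first factor is `i x` to first order, and the averaging factor tends to `1`, so the limit
does not depend on the position `t` in the cell. -/
theorem tendsto_cellSlope {x y : ℕ → ℝ} {L M : ℝ}
    (hx : Tendsto (fun n : ℕ => ((n : ℝ) + 1) * x n) atTop (𝓝 L))
    (hy : Tendsto (fun n : ℕ => ((n : ℝ) + 1) * y n) atTop (𝓝 M)) (t : ℝ) :
    Tendsto (fun n : ℕ => ((n : ℂ) + 1) * cellSlope (x n) (y n) t) atTop (𝓝 (L * Complex.I)) := by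
  have hd : HasDerivAt (fun r : ℝ => Complex.exp (r * Complex.I)) Complex.I 0 := by
    have h1 : HasDerivAt (fun r : ℝ => (r : ℂ) * Complex.I) Complex.I 0 := by
      simpa using (Complex.ofRealCLM.hasDerivAt (x := 0)).mul_const Complex.I
    simpa using h1.cexp
  have h1 := tendsto_rescaled hd hx
  have h2 : Tendsto (fun n => ((1 : ℂ) - t) + t * Complex.exp (y n * Complex.I)) atTop (𝓝 1) := by
    have hc : Continuous fun r : ℝ => ((1 : ℂ) - t) + t * Complex.exp (r * Complex.I) := by
      fun_prop
    simpa [Function.comp_def] using (hc.tendsto 0).comp (tendsto_zero_of_rescaled hy)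
  have h3 := h1.mul h2
  simp only [mul_one, Complex.real_smul] at h3
  refine h3.congr fun n => ?_
  rw [cellSlope]
  push_cast
  simp only [zero_mul, Complex.exp_zero]
  ring

theorem frobSq_smulRight (l : Plane →L[ℝ] ℝ) (a : Plane) :
    frobSq (l.smulRight a) = ‖a‖ ^ 2 * ∑ i, l (EuclideanSpace.single i 1) ^ 2 := by
  rw [frobSq, Finset.mul_sum]
  refine Finset.sum_congr rfl fun i _ => ?_
  rw [ContinuousLinearMap.smulRight_apply, norm_smul, mul_pow, Real.norm_eq_abs, sq_abs, mul_comm]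

/-- The two rescaled slopes recombine, by `l = ∑ l (A e_i) coord_i`, to `i l (e)` at every point of
the cell. Since `(n + 1) p n` is bounded, the integrands are uniformly bounded and dominated
convergence applies. -/
theorem tendsto_integral_waveSlope {A B : Mat} (hA : A.det ≠ 0) (hB : B.det ≠ 0)
    {l : Plane →L[ℝ] ℝ} {p : ℕ → Fin 2 → ℝ}
    (hp : ∀ i, Tendsto (fun n : ℕ => ((n : ℝ) + 1) * p n i) atTop
      (𝓝 (l (act A (EuclideanSpace.single i 1))))) (a : Plane) :
    Tendsto (fun n : ℕ => ((n : ℝ) + 1) ^ 2 * ∫ ω, ‖a‖ ^ 2 * ∑ i, Complex.normSq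
        (waveSlope A (p n) (EuclideanSpace.single i 1) ω.1) ∂(cellMeasure A B)) atTop
      (𝓝 (frobSq (l.smulRight a))) := by
  have := isProbabilityMeasure_cellMeasure hA hB
  have hlim : frobSq (l.smulRight a) = ∫ _ω, frobSq (l.smulRight a) ∂(cellMeasure A B) := by simp
  rw [hlim]
  simp only [← integral_const_mul]
  obtain ⟨M, hM⟩ : ∃ M : ℝ, ∀ (n : ℕ) i, |((n : ℝ) + 1) * p n i| ≤ M := by
    obtain ⟨M0, h0⟩ := (hp 0).abs.bddAbove_range
    obtain ⟨M1, h1⟩ := (hp 1).abs.bddAbove_range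
    refine ⟨max M0 M1, fun n i => ?_⟩
    fin_cases i
    · exact (h0 ⟨n, rfl⟩).trans (le_max_left _ _)
    · exact (h1 ⟨n, rfl⟩).trans (le_max_right _ _)
  have hM0 : 0 ≤ M := (abs_nonneg _).trans (hM 0 0)
  have hbound : ∀ (n : ℕ) e α, ‖((n : ℂ) + 1) * waveSlope A (p n) e α‖ ≤
      (|coord A 0 e| + |coord A 1 e|) * M := by
    intro n e α
    have hn : ‖(n : ℂ) + 1‖ = |(n : ℝ) + 1| := by
      rw [← Real.norm_eq_abs, ← Complex.norm_real]
      push_cast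
      rfl
    rw [norm_mul, hn]
    calc |(n : ℝ) + 1| * ‖waveSlope A (p n) e α‖
        ≤ |(n : ℝ) + 1| * (|coord A 0 e| * |p n 0| + |coord A 1 e| * |p n 1|) := by
          gcongr
          exact norm_waveSlope_le A (p n) e α
      _ = |coord A 0 e| * |((n : ℝ) + 1) * p n 0| + |coord A 1 e| * |((n : ℝ) + 1) * p n 1| := by
          rw [abs_mul, abs_mul]; ring
      _ ≤ |coord A 0 e| * M + |coord A 1 e| * M := by gcongr <;> exact hM n _
      _ = _ := by ring
  have hsq : ∀ (n : ℕ) (ω : Plane × Plane), ((n : ℝ) + 1) ^ 2 * (‖a‖ ^ 2 * ∑ i, Complex.normSq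
      (waveSlope A (p n) (EuclideanSpace.single i 1) ω.1)) =
      ‖a‖ ^ 2 * ∑ i, ‖((n : ℂ) + 1) * waveSlope A (p n) (EuclideanSpace.single i 1) ω.1‖ ^ 2 := by
    intro n ω
    rw [← mul_assoc, mul_comm (_ ^ 2) (‖a‖ ^ 2), mul_assoc, Finset.mul_sum]
    congr 1
    refine Finset.sum_congr rfl fun i _ => ?_
    rw [← Complex.normSq_eq_norm_sq, Complex.normSq_mul]
    congr 1
    rw [← Complex.ofReal_natCast, ← Complex.ofReal_one, ← Complex.ofReal_add,
      Complex.normSq_ofReal, sq]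
  simp only [hsq]
  refine tendsto_integral_of_dominated_convergence
    (fun _ => ‖a‖ ^ 2 * ∑ i, ((|coord A 0 (EuclideanSpace.single i 1)| +
      |coord A 1 (EuclideanSpace.single i 1)|) * M) ^ 2) (fun n => ?_) (integrable_const _)
    (fun n => Eventually.of_forall fun ω => ?_) (Eventually.of_forall fun ω => ?_)
  · refine Measurable.aestronglyMeasurable (Measurable.const_mul ?_ _)
    refine Finset.measurable_sum _ fun i _ => ?_
    exact ((((measurable_waveSlope A (p n) _).comp measurable_fst).const_mul _).norm).pow_const 2
  · rw [Real.norm_of_nonneg (by positivity)]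
    gcongr with i _
    exact hbound n _ _
  · rw [frobSq_smulRight]
    refine (tendsto_finsetSum _ fun i _ => ?_).const_mul _
    set e : Plane := EuclideanSpace.single i 1
    have h1 := ((tendsto_cellSlope (hp 0) (hp 1) (Int.fract (coord A 1 ω.1))).const_mul
      (coord A 0 e : ℂ)).add
      ((tendsto_cellSlope (hp 1) (hp 0) (Int.fract (coord A 0 ω.1))).const_mul
      (coord A 1 e : ℂ))
    have h2 : (coord A 0 e : ℂ) * (l (act A (EuclideanSpace.single 0 1)) * Complex.I) +
        (coord A 1 e : ℂ) * (l (act A (EuclideanSpace.single 1 1)) * Complex.I) =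
        l e * Complex.I := by
      have h3 : l e = coord A 0 e * l (act A (EuclideanSpace.single 0 1)) +
          coord A 1 e * l (act A (EuclideanSpace.single 1 1)) := by
        conv_lhs => rw [eq_sum_coord hA e]
        simp [Fin.sum_univ_two]
      rw [h3]
      push_cast
      ring
    rw [h2] at h1
    have h3 := (h1.norm).pow 2
    rw [norm_mul, Complex.norm_I, mul_one, Complex.norm_real, Real.norm_eq_abs, sq_abs] at h3
    refine h3.congr fun n => ?_
    rw [waveSlope]
    congr 2
    ring

/-- Lattice coordinates are integers, so a congruence modulo 2π on the columns of `A` extends to the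
lattice. On bonds, the large `K` may therefore be replaced by the small functional with values `p`.
-/
theorem exists_int_of_mem_lattice {A : Mat} (hA : A.det ≠ 0) {K : Plane →L[ℝ] ℝ} {p : Fin 2 → ℝ}
    (hp : ∀ i, ∃ z : ℤ, K (act A (EuclideanSpace.single i 1)) = p i + z * (2 * Real.pi))
    {ρ : Plane} (hρ : ρ ∈ lattice A) :
    ∃ z : ℤ, K ρ = (∑ i, p i • coord A i) ρ + z * (2 * Real.pi) := by
  obtain ⟨x, rfl⟩ := hρ
  choose z hz using hp
  refine ⟨∑ i, x i * z i, ?_⟩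
  have hc : ∀ i, coord A i (act A (intVec x)) = x i := fun i => by
    rw [coord_apply, act_inv_act hA, intVec_apply]
  change K (act A (intVec x)) = (∑ i, p i • coord A i) (act A (intVec x)) + _
  rw [act_eq_sum A (intVec x)]
  conv_rhs => rw [← act_eq_sum A (intVec x)]
  simp only [map_sum, map_smul, sum_apply, smul_apply, hc, hz, smul_eq_mul, intVec_apply]
  push_cast
  rw [Finset.sum_mul, ← Finset.sum_add_distrib]
  exact Finset.sum_congr rfl fun i _ => by ring

/-- Rescaled second differentials along the stencils of long plane waves. -/
theorem IsSitePotential.tendsto_hessian_wave {A : Mat} (hA : A.det ≠ 0) {κ₀ : ℝ}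
    {V : (Bond A → Plane) → ℝ} (hV : IsSitePotential A κ₀ V) {l : Plane →L[ℝ] ℝ}
    {K : ℕ → Plane →L[ℝ] ℝ} {p : ℕ → Fin 2 → ℝ}
    (hK : ∀ n i, ∃ z : ℤ, K n (act A (EuclideanSpace.single i 1)) = p n i + z * (2 * Real.pi))
    (hp : ∀ i, Tendsto (fun n : ℕ => ((n : ℝ) + 1) * p n i) atTop
      (𝓝 (l (act A (EuclideanSpace.single i 1))))) (a : Plane) :
    Tendsto (fun n : ℕ => ((n : ℝ) + 1) ^ 2 *
      (hessian V (cosStencil A (K n) a) (cosStencil A (K n) a) +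
        hessian V (sinStencil A (K n) a) (sinStencil A (K n) a))) atTop
      (𝓝 (hessian V (cbStencil A (l.smulRight a)) (cbStencil A (l.smulRight a)))) := by
  set Q : ℕ → Plane →L[ℝ] ℝ := fun n => ∑ i, p n i • coord A i with hQ
  have hQlim : Tendsto (fun n : ℕ => ((n : ℝ) + 1) • Q n) atTop (𝓝 l) := by
    rw [eq_sum_apply_smul_coord hA l]
    simp only [hQ, Finset.smul_sum, smul_smul]
    exact tendsto_finsetSum _ fun i _ => (hp i).smul_const _
  have hcos : ∀ n, cosStencil A (K n) a = cosStencil A (Q n) a := by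
    intro n
    ext1
    funext ρ
    obtain ⟨z, hz⟩ := exists_int_of_mem_lattice hA (hK n) ρ.2.1
    rw [cosStencil_apply, cosStencil_apply, hz, Real.cos_add_int_mul_two_pi]
  have hsin : ∀ n, sinStencil A (K n) a = sinStencil A (Q n) a := by
    intro n
    ext1
    funext ρ
    obtain ⟨z, hz⟩ := exists_int_of_mem_lattice hA (hK n) ρ.2.1
    rw [sinStencil_apply, sinStencil_apply, hz, Real.sin_add_int_mul_two_pi]
  obtain ⟨M, hM⟩ := hQlim.norm.bddAbove_range
  have hM' : ∀ n : ℕ, ‖(n : ℝ) + 1‖ * (‖Q n‖ * ‖a‖) ≤ M * ‖a‖ := fun n => by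
    rw [← mul_assoc, ← norm_smul]
    gcongr
    exact hM ⟨n, rfl⟩
  have hpt : ∀ x : Plane, Tendsto (fun n : ℕ => ((n : ℝ) + 1) * Q n x) atTop (𝓝 (l x)) := by
    intro x
    exact ((ContinuousLinearMap.apply ℝ ℝ x).continuous.tendsto l).comp hQlim
  -- `cos - 1` is of second order, so the real part vanishes in the limit even after rescaling.
  have h1 := hV.tendsto_hessian (Y := fun n : ℕ => ((n : ℝ) + 1) • cosStencil A (Q n) a) (Z := 0)
    (C := M * ‖a‖) (fun n ρ => by
      refine le_trans ?_ (hM' n)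
      change ‖((n : ℝ) + 1) • cosStencil A (Q n) a ρ‖ ≤ _
      rw [norm_smul]
      gcongr
      exact norm_scalarStencil_apply_le _ _ _ _ _) (fun ρ => by
      change Tendsto (fun n : ℕ => ((n : ℝ) + 1) • cosStencil A (Q n) a ρ) atTop (𝓝 0)
      have h := tendsto_rescaled (Real.hasDerivAt_cos 0) (hpt ρ.1)
      simp only [Real.sin_zero, neg_zero, smul_zero, Real.cos_zero] at h
      have h' := (h.const_mul ‖ρ.1‖⁻¹).smul_const a
      rw [mul_zero, zero_smul] at h'
      refine h'.congr fun n => ?_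
      rw [cosStencil_apply, smul_smul, smul_eq_mul, mul_left_comm])
  -- The sine part linearizes on each bond to `l (ρ) a`, the stencil of the homogeneous rank-one
  -- deformation.
  have h2 := hV.tendsto_hessian (Y := fun n : ℕ => ((n : ℝ) + 1) • sinStencil A (Q n) a)
    (Z := cbStencil A (l.smulRight a)) (C := M * ‖a‖) (fun n ρ => by
      refine le_trans ?_ (hM' n)
      change ‖((n : ℝ) + 1) • sinStencil A (Q n) a ρ‖ ≤ _
      rw [norm_smul]
      gcongr
      exact norm_scalarStencil_apply_le _ _ _ _ _) (fun ρ => by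
      change Tendsto (fun n : ℕ => ((n : ℝ) + 1) • sinStencil A (Q n) a ρ) atTop _
      have h := tendsto_rescaled (Real.hasDerivAt_sin 0) (hpt ρ.1)
      simp only [Real.sin_zero, Real.cos_zero, sub_zero, smul_eq_mul, mul_one] at h
      have h' := (h.const_mul ‖ρ.1‖⁻¹).smul_const a
      rw [cbStencil_apply, ContinuousLinearMap.smulRight_apply, smul_smul]
      refine h'.congr fun n => ?_
      rw [sinStencil_apply, smul_smul, mul_left_comm])
  have h3 := h1.add h2
  have hzero : hessian V (0 : Stencil A) 0 = 0 := by simp [hessian_eq]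
  rw [hzero, zero_add] at h3
  refine h3.congr fun n => ?_
  simp only [hcos, hsin, hessian_eq, map_smul, smul_apply, smul_eq_mul]
  ring

/-- Atomistic stability implies the Legendre–Hadamard condition for the Cauchy–Born energy. -/
theorem IsSitePotential.legendre_hadamard {A B : Mat} (hA : A.det ≠ 0) (hB : B.det ≠ 0)
    (hAB : lattice A ∩ lattice B = {0}) {κ₀ : ℝ} (hκ : 0 < κ₀) {V : (Bond A → Plane) → ℝ}
    (hV : IsSitePotential A κ₀ V) (hC : 0 < layerConst A B V) (l : Plane →L[ℝ] ℝ) (a : Plane) :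
    layerConst A B V * frobSq (l.smulRight a) ≤
      hessian V (cbStencil A (l.smulRight a)) (cbStencil A (l.smulRight a)) := by
  by_cases hzero : l.smulRight a = 0
  · rw [hzero]
    simp [frobSq, hessian_eq]
  have hpos : 0 < frobSq (l.smulRight a) := by
    refine (Finset.sum_nonneg fun i _ => sq_nonneg _).lt_of_ne' fun h0 => hzero ?_
    have h1 := (Finset.sum_eq_zero_iff_of_nonneg fun i _ => sq_nonneg _).mp h0
    ext1 x
    rw [eq_sum_single x, map_sum]
    refine (Finset.sum_eq_zero fun i hi => ?_).trans (by simp)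
    rw [map_smul, norm_eq_zero.mp (pow_eq_zero_iff two_ne_zero |>.mp (h1 i hi)), smul_zero]
  obtain ⟨K, p, hK, hp, hlim⟩ := exists_wave_vectors hA hB hAB l
  have h1 := tendsto_integral_waveSlope hA hB hlim a
  have h2 := hV.tendsto_hessian_wave hA hp hlim a
  refine le_of_tendsto_of_tendsto (h1.const_mul _) h2 ?_
  -- For large `n` the averaged squared gradient is positive, as the normalization `‖∇v‖ = 1`
  -- requires.
  filter_upwards [h1.eventually_const_lt hpos] with n hn
  have hn1 : (0 : ℝ) < ((n : ℝ) + 1) ^ 2 := by positivity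
  rw [mul_left_comm]
  refine mul_le_mul_of_nonneg_left ?_ hn1.le
  refine hV.layerConst_mul_le_hessian hA hB hκ hC (hK n) (fun i => ?_) a
    (pos_of_mul_pos_right hn hn1.le)
  obtain ⟨z, hz⟩ := hp n i
  rw [hz, Complex.exp_eq_exp_iff_exists_int]
  exact ⟨z, by push_cast; ring⟩

end Moire
end

noncomputable section

namespace Moire

open Filter Topology

/-! ### Stability of the Cauchy–Born energy -/

set_option maxSynthPendingDepth 3 in
/-- The bilinear form of the squared Frobenius norm. -/
def frobForm : MapForm :=
  ∑ i, (innerSL ℝ).bilinearComp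
    (ContinuousLinearMap.apply ℝ Plane (EuclideanSpace.single i 1 : Plane))
    (ContinuousLinearMap.apply ℝ Plane (EuclideanSpace.single i 1 : Plane))

set_option maxSynthPendingDepth 3 in
theorem frobForm_apply (T : Plane →L[ℝ] Plane) : frobForm T T = frobSq T := by
  simp only [frobForm, sum_apply, frobSq]
  refine Finset.sum_congr rfl fun i _ => ?_
  exact real_inner_self_eq_norm_sq (T (EuclideanSpace.single i 1))

/-- The second differential at `0` of the Cauchy–Born energy density. -/
def cbForm {A : Mat} (V : (Bond A → Plane) → ℝ) : MapForm :=
  (fderiv ℝ (fderiv ℝ (potential V)) 0).bilinearComp (cbStencil A) (cbStencil A)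

theorem cbForm_apply {A : Mat} (V : (Bond A → Plane) → ℝ) (T : Plane →L[ℝ] Plane) :
    cbForm V T T = hessian V (cbStencil A T) (cbStencil A T) := by
  rw [hessian_eq]
  rfl

theorem integrable_mapForm (R : MapForm) {g : Plane → Plane →L[ℝ] Plane}
    (hg : MemLp g 2 (volume.restrict unitCell)) :
    Integrable (fun y => R (g y) (g y)) (volume.restrict unitCell) := by
  have hent : ∀ p, MemLp (fun y => entry p (g y)) 2 (volume.restrict unitCell) := fun p =>
    (entry p).comp_memLp' hg
  simp only [mapForm_apply R (g _)]
  exact integrable_finsetSum _ fun p _ => integrable_finsetSum _ fun q _ =>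
    ((hent p).integrable_mul (hent q)).mul_const _

/-- Cauchy–Schwarz in coordinates. It turns operator norm estimates of the second differential into
multiples of the gradient density. -/
theorem norm_sq_le_frobSq (T : Plane →L[ℝ] Plane) : ‖T‖ ^ 2 ≤ frobSq T := by
  have h0 : 0 ≤ frobSq T := Finset.sum_nonneg fun i _ => sq_nonneg _
  refine Real.le_sqrt (norm_nonneg _) h0 |>.mp ?_
  refine T.opNorm_le_bound (Real.sqrt_nonneg _) fun x => ?_
  refine le_of_sq_le_sq ?_ (by positivity)
  rw [mul_pow, Real.sq_sqrt h0, EuclideanSpace.real_norm_sq_eq x, frobSq]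
  have h1 : ‖T x‖ ≤ ∑ i, ‖T (EuclideanSpace.single i 1)‖ * |x i| := by
    conv_lhs => rw [eq_sum_single x, map_sum]
    refine (norm_sum_le _ _).trans (Finset.sum_le_sum fun i _ => ?_)
    rw [map_smul, norm_smul, Real.norm_eq_abs, mul_comm]
  calc ‖T x‖ ^ 2 ≤ (∑ i, ‖T (EuclideanSpace.single i 1)‖ * |x i|) ^ 2 := by gcongr
    _ ≤ (∑ i, ‖T (EuclideanSpace.single i 1)‖ ^ 2) * ∑ i, |x i| ^ 2 :=
      Finset.sum_mul_sq_le_sq_mul_sq _ _ _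
    _ = _ := by simp only [sq_abs]

set_option maxSynthPendingDepth 3 in
-- The form `R - ν |·|²` is nonnegative on rank-one matrices, hence so is its average over the
-- gradient of a periodic function.
theorem IsSobolev.mul_integral_frobSq_le {M : Mat} (hM : M.det ≠ 0)
    {v : Fin 2 → Plane → Plane} {G : Fin 2 → Plane → Plane →L[ℝ] Plane}
    (h : IsSobolev M 2 v G) (j : Fin 2) {R : MapForm} {ν : ℝ}
    (hR : ∀ (l : Plane →L[ℝ] ℝ) (a : Plane),
      ν * frobSq (l.smulRight a) ≤ R (l.smulRight a) (l.smulRight a)) :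
    ν * ∫ y in unitCell, frobSq (G j (act M y)) ≤
      ∫ y in unitCell, R (G j (act M y)) (G j (act M y)) := by
  have hg := memLp_comp_act hM (h.memLp_grad j)
  have h1 := h.average_mapForm_nonneg hM j (R - ν • frobForm) fun l a => by
    simp only [sub_apply, smul_apply, frobForm_apply, smul_eq_mul]
    linarith [hR l a]
  rw [average_cell hM] at h1
  simp only [sub_apply, smul_apply, smul_eq_mul] at h1
  rw [integral_sub (integrable_mapForm R hg) ((integrable_mapForm frobForm hg).const_mul ν),
    integral_const_mul] at h1
  simp only [frobForm_apply] at h1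
  linarith

theorem ae_norm_le_of_eLpNorm_top_le {H : Plane → Plane →L[ℝ] Plane} {μ : Measure Plane} {κ : ℝ}
    (hκ : 0 ≤ κ) (h : eLpNorm H ⊤ μ ≤ ENNReal.ofReal κ) : ∀ᵐ x ∂μ, ‖H x‖ ≤ κ := by
  rw [eLpNorm_exponent_top] at h
  filter_upwards [ae_le_eLpNormEssSup (f := H) (μ := μ)] with x hx
  have h1 := hx.trans h
  rwa [← ofReal_norm, ENNReal.ofReal_le_ofReal_iff hκ] at h1

/-- The second differential of the Cauchy–Born energy density is measurable along measurable
fields of small strains. -/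
theorem IsSitePotential.aestronglyMeasurable_iteratedFDeriv {A : Mat} {κ₀ : ℝ}
    {V : (Bond A → Plane) → ℝ} (hV : IsSitePotential A κ₀ V) {μ : Measure Plane}
    {H G : Plane → Plane →L[ℝ] Plane} (hH : AEStronglyMeasurable H μ)
    (hG : AEStronglyMeasurable G μ) (hbd : ∀ᵐ x ∂μ, ‖H x‖ < κ₀) :
    AEStronglyMeasurable
      (fun x => iteratedFDeriv ℝ 2 (cauchyBorn V) (H x) ![G x, G x]) μ := by
  classical
  let Ψ : (Plane →L[ℝ] Plane) × (Plane →L[ℝ] Plane) → ℝ := fun q =>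
    fderiv ℝ (fderiv ℝ (potential V)) (cbStencil A q.1) (cbStencil A q.2) (cbStencil A q.2)
  let s : Set ((Plane →L[ℝ] Plane) × (Plane →L[ℝ] Plane)) := {q | ‖q.1‖ < κ₀}
  have hs : IsOpen s := isOpen_lt (by fun_prop) continuous_const
  have hΨ : ContinuousOn Ψ s := by
    intro q hq
    have h1 : ContDiffAt ℝ 2 (potential V) (cbStencil A q.1) :=
      hV.contDiffAt ((norm_cbStencil_le A q.1).trans_lt hq)
    have h2 : ContDiffAt ℝ 0 (fderiv ℝ (fderiv ℝ (potential V))) (cbStencil A q.1) :=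
      (h1.fderiv_right (m := 1) (by norm_num)).fderiv_right (by norm_num)
    have h3 : ContinuousAt (fun q : (Plane →L[ℝ] Plane) × (Plane →L[ℝ] Plane) =>
        fderiv ℝ (fderiv ℝ (potential V)) (cbStencil A q.1)) q :=
      ContinuousAt.comp (g := fderiv ℝ (fderiv ℝ (potential V))) h2.continuousAt
        ((cbStencil A).continuous.comp continuous_fst).continuousAt
    have h4 : ContinuousAt (fun q : (Plane →L[ℝ] Plane) × (Plane →L[ℝ] Plane) =>
        cbStencil A q.2) q := ((cbStencil A).continuous.comp continuous_snd).continuousAt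
    exact ((h3.clm_apply h4).clm_apply h4).continuousWithinAt
  -- The second differential is controlled only on the open set of small strains; extension by zero
  -- gives a Borel function, equal to it almost everywhere along `H`.
  have hm : Measurable (s.piecewise Ψ 0) :=
    hΨ.measurable_piecewise continuousOn_const hs.measurableSet
  have hc := hm.comp_aemeasurable (hH.aemeasurable.prodMk hG.aemeasurable)
  refine AEStronglyMeasurable.congr hc.aestronglyMeasurable ?_
  filter_upwards [hbd] with x hx
  rw [hV.iteratedFDeriv_cauchyBorn hx]
  exact piecewise_eq_of_mem s Ψ 0 hx

/-- Near the reference state, the second differential of the Cauchy–Born energy density is close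
to its value at the reference state. -/
theorem IsSitePotential.exists_close {A : Mat} {κ₀ : ℝ} (hκ : 0 < κ₀) {V : (Bond A → Plane) → ℝ}
    (hV : IsSitePotential A κ₀ V) {ε : ℝ} (hε : 0 < ε) :
    ∃ δ : ℝ, 0 < δ ∧ δ ≤ κ₀ ∧ ∀ T S : Plane →L[ℝ] Plane, ‖T‖ < δ →
      |iteratedFDeriv ℝ 2 (cauchyBorn V) T ![S, S] - cbForm V S S| ≤ ε * frobSq S := by
  have h1 : ContDiffAt ℝ 2 (potential V) 0 := hV.contDiffAt (by simpa using hκ)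
  have h2 : ContDiffAt ℝ 0 (fderiv ℝ (fderiv ℝ (potential V))) 0 :=
    (h1.fderiv_right (m := 1) (by norm_num)).fderiv_right (by norm_num)
  obtain ⟨r, hr, hball⟩ := Metric.continuousAt_iff.mp h2.continuousAt ε hε
  refine ⟨min r κ₀, lt_min hr hκ, min_le_right _ _, fun T S hT => ?_⟩
  rw [hV.iteratedFDeriv_cauchyBorn (hT.trans_le (min_le_right _ _)), cbForm]
  have h3 := hball (x := cbStencil A T) (by
    rw [dist_zero_right]
    exact ((norm_cbStencil_le A T).trans_lt hT).trans_le (min_le_left _ _))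
  rw [dist_eq_norm] at h3
  set D := fderiv ℝ (fderiv ℝ (potential V)) (cbStencil A T) -
    fderiv ℝ (fderiv ℝ (potential V)) 0 with hD
  change |D (cbStencil A S) (cbStencil A S)| ≤ _
  calc |D (cbStencil A S) (cbStencil A S)|
      ≤ ‖D‖ * ‖cbStencil A S‖ * ‖cbStencil A S‖ := D.le_opNorm₂ _ _
    _ ≤ ε * ‖S‖ * ‖S‖ := by
        have := norm_cbStencil_le A S
        gcongr
    _ = ε * ‖S‖ ^ 2 := by ring
    _ ≤ ε * frobSq S := by gcongr; exact norm_sq_le_frobSq S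

/-- Stability under perturbations of the reference state. -/
theorem IsSobolev.stability {E : Fin 2 → Mat} (hM : (moire E).det ≠ 0)
    {V : ∀ j, (Bond (E j) → Plane) → ℝ} {κ₀ : ℝ} (hV : ∀ j, IsSitePotential (E j) κ₀ (V j))
    {ν ε : ℝ} (hLH : ∀ j (l : Plane →L[ℝ] ℝ) (a : Plane),
      ν * frobSq (l.smulRight a) ≤ cbForm (V j) (l.smulRight a) (l.smulRight a))
    {H : Fin 2 → Plane → Plane →L[ℝ] Plane}
    (hHm : ∀ j, AEStronglyMeasurable (fun y => H j (act (moire E) y)) (volume.restrict unitCell))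
    (hH0 : ∀ j, ∀ᵐ y ∂(volume.restrict unitCell), ‖H j (act (moire E) y)‖ < κ₀)
    (hH : ∀ j, ∀ᵐ y ∂(volume.restrict unitCell), ∀ S : Plane →L[ℝ] Plane,
      |iteratedFDeriv ℝ 2 (cauchyBorn (V j)) (H j (act (moire E) y)) ![S, S] -
        cbForm (V j) S S| ≤ ε * frobSq S)
    {v : Fin 2 → Plane → Plane} {G : Fin 2 → Plane → Plane →L[ℝ] Plane}
    (h : IsSobolev (moire E) 2 v G) :
    (ν - ε) * gradSq (moire E) G ≤ cbSecondVar E V H G := by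
  set M := moire E
  have hg : ∀ j, MemLp (fun y => G j (act M y)) 2 (volume.restrict unitCell) := fun j =>
    memLp_comp_act hM (h.memLp_grad j)
  have ifrob : ∀ j, Integrable (fun y => frobSq (G j (act M y))) (volume.restrict unitCell) :=
    fun j => by simpa only [frobForm_apply] using integrable_mapForm frobForm (hg j)
  have icb : ∀ j, Integrable (fun y => cbForm (V j) (G j (act M y)) (G j (act M y)))
      (volume.restrict unitCell) := fun j => integrable_mapForm _ (hg j)
  -- Integrability of the perturbed density comes from comparison with the constant coefficient
  -- form, which is integrable because `∇v` is in `L²`.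
  have idiff : ∀ j, Integrable (fun y =>
      iteratedFDeriv ℝ 2 (cauchyBorn (V j)) (H j (act M y)) ![G j (act M y), G j (act M y)] -
        cbForm (V j) (G j (act M y)) (G j (act M y))) (volume.restrict unitCell) := by
    intro j
    refine ((ifrob j).const_mul ε).mono' ?_ ?_
    · exact ((hV j).aestronglyMeasurable_iteratedFDeriv (hHm j) (hg j).aestronglyMeasurable
        (hH0 j)).sub (icb j).aestronglyMeasurable
    · filter_upwards [hH j] with y hy using hy _
  have iW : ∀ j, Integrable (fun y =>
      iteratedFDeriv ℝ 2 (cauchyBorn (V j)) (H j (act M y)) ![G j (act M y), G j (act M y)])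
      (volume.restrict unitCell) := fun j => by
    refine ((idiff j).add (icb j)).congr (Filter.Eventually.of_forall fun y => ?_)
    exact sub_add_cancel _ _
  rw [gradSq, cbSecondVar, average_cell hM, average_cell hM,
    integral_finsetSum _ fun j _ => ifrob j, integral_finsetSum _ fun j _ => iW j, Finset.mul_sum]
  refine Finset.sum_le_sum fun j _ => ?_
  have h1 := h.mul_integral_frobSq_le hM j (hLH j)
  have h2 : ∫ y in unitCell, (cbForm (V j) (G j (act M y)) (G j (act M y)) -
      ε * frobSq (G j (act M y))) ≤ ∫ y in unitCell,
      iteratedFDeriv ℝ 2 (cauchyBorn (V j)) (H j (act M y)) ![G j (act M y), G j (act M y)] := by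
    refine integral_mono_ae ((icb j).sub ((ifrob j).const_mul ε)) (iW j) ?_
    filter_upwards [hH j] with y hy
    have := (abs_le.mp (hy (G j (act M y)))).1
    linarith
  rw [integral_sub (icb j) ((ifrob j).const_mul ε), integral_const_mul] at h2
  rw [sub_mul]
  linarith

end Moire

end

/-! ### Conclusion: from the Legendre–Hadamard condition to both stability estimates. -/

theorem proposition4p1
    (E : Fin 2 → Moire.Mat)
    (hE : ∀ j, (E j).det ≠ 0)
    (hM : ((E 1)⁻¹ - (E 0)⁻¹).det ≠ 0)
    (hR : Moire.lattice (E 0) ∩ Moire.lattice (E 1) = {0})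
    (V : ∀ j, (Moire.Bond (E j) → Moire.Plane) → ℝ)
    (κ₀ : ℝ) (hκ₀ : 0 < κ₀)
    (hV : ∀ j, Moire.IsSitePotential (E j) κ₀ (V j))
    (hν : 0 < Moire.stabConst E V) :
    (∀ v G, Moire.IsSobolev (Moire.moire E) 2 v G →
      Moire.stabConst E V * Moire.gradSq (Moire.moire E) G ≤ Moire.cbSecondVar E V 0 G) ∧
    ∃ κ₁ : ℝ, 0 < κ₁ ∧ ∀ κ : ℝ, 0 < κ → κ < κ₁ →
      ∀ u H, Moire.IsAdmissible (Moire.moire E) κ u H →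
      ∀ v G, Moire.IsSobolev (Moire.moire E) 2 v G →
        1 / 2 * Moire.stabConst E V * Moire.gradSq (Moire.moire E) G ≤
          Moire.cbSecondVar E V H G := by
  open Moire in
  have hMoire : (moire E).det ≠ 0 := by
    rw [moire, Matrix.det_nonsing_inv, Ring.inverse_eq_inv']
    exact inv_ne_zero hM
  obtain ⟨h0, h1⟩ := lt_min_iff.mp hν
  have hLH : ∀ j (l : Plane →L[ℝ] ℝ) (a : Plane),
      stabConst E V * frobSq (l.smulRight a) ≤
        cbForm (V j) (l.smulRight a) (l.smulRight a) := by
    intro j l a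
    have hf : 0 ≤ frobSq (l.smulRight a) := Finset.sum_nonneg fun i _ => sq_nonneg _
    rw [cbForm_apply]
    fin_cases j
    · exact (mul_le_mul_of_nonneg_right (min_le_left _ _) hf).trans
        ((hV 0).legendre_hadamard (hE 0) (hE 1) hR hκ₀ h0 l a)
    · exact (mul_le_mul_of_nonneg_right (min_le_right _ _) hf).trans
        ((hV 1).legendre_hadamard (hE 1) (hE 0) (by rw [Set.inter_comm, hR]) hκ₀ h1 l a)
  refine ⟨fun v G h => ?_, ?_⟩
  -- At the reference state there is no perturbation, so the full constant survives.
  · have h2 := h.stability hMoire hV (ε := 0) (H := 0) hLH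
      (fun j => MeasureTheory.aestronglyMeasurable_const)
      (fun j => Filter.Eventually.of_forall fun y => by simpa using hκ₀)
      (fun j => Filter.Eventually.of_forall fun y S => by
        rw [zero_mul]
        refine le_of_eq (abs_eq_zero.mpr (sub_eq_zero.mpr ?_))
        refine ((hV j).iteratedFDeriv_cauchyBorn (T := 0) (by simpa using hκ₀) S).trans ?_
        rw [map_zero]
        rfl)
    rwa [sub_zero] at h2
  -- A perturbation of relative size `ν / 2` leaves `ν - ν / 2`; the smaller of the two radii serves
  -- both layers.
  · choose δ hδ hδκ hclose using fun j => (hV j).exists_close hκ₀ (half_pos hν)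
    refine ⟨min (δ 0) (δ 1), lt_min (hδ 0) (hδ 1), fun κ hκ hκ1 u H hH v G h => ?_⟩
    have hlt : ∀ j, κ < δ j := fun j => by
      fin_cases j
      · exact hκ1.trans_le (min_le_left _ _)
      · exact hκ1.trans_le (min_le_right _ _)
    have hae : ∀ j, ∀ᵐ y ∂(MeasureTheory.volume.restrict unitCell),
        ‖H j (act (moire E) y)‖ < δ j := fun j => by
      filter_upwards [ae_comp_act hMoire (ae_norm_le_of_eLpNorm_top_le hκ.le (hH.2 j))]
        with y hy using hy.trans_lt (hlt j)
    have h2 := h.stability hMoire hV (ε := stabConst E V / 2) hLH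
      (fun j => (memLp_comp_act hMoire (hH.1.memLp_grad j)).aestronglyMeasurable)
      (fun j => by filter_upwards [hae j] with y hy using hy.trans_le (hδκ j))
      (fun j => by filter_upwards [hae j] with y hy S using hclose j _ S hy)
    have h3 : stabConst E V - stabConst E V / 2 = 1 / 2 * stabConst E V := by ring
    rwa [h3] at h2
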